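/- **Conventions.** Let $n\ge 1$. All functions are complex-valued, Lebesgue measurable on $\mathbb{R}^n$ and identified when they agree almost everywhere. For $1\le q\le p<\infty$ and $r>0$ put $$m(f,p,q;r):=\sup_{x\in\mathbb{R}^n}|B(x,r)|^{\frac1p}\left(\frac{1}{|B(x,r)|}\int_{B(x,r)}|f(y)|^q\,dy\right)^{\frac1q},$$ and let $\mathcal{M}^p_q$ be the Morrey space of all $f\in L^q_{\rm loc}(\mathbb{R}^n)$ with $\|f\|_{\mathcal{M}^p_q}:=\sup_{r>0}m(f,p,q;r)<\infty$. Its vanishing subspaces, which carry the norm of $\mathcal{M}^p_q$, are $$V_0\mathcal{M}^p_q:=\Big\{f\in\mathcal{M}^p_q:\lim_{r\to0^+}m(f,p,q;r)=0\Big\},\qquad V_\infty\mathcal{M}^p_q:=\Big\{f\in\mathcal{M}^p_q:\lim_{r\to\infty}m(f,p,q;r)=0\Big\},$$ $$V^{(*)}\mathcal{M}^p_q:=\Big\{f\in\mathcal{M}^p_q:\lim_{N\to\infty}\sup_{x\in\mathbb{R}^n}\int_{B(x,1)}|f(y)|^q\chi_{\mathbb{R}^n\setminus B(0,N)}(y)\,dy=0\Big\}.$$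 Let $S=\{z\in\mathbb{C}:0<\operatorname{Re}z<1\}$. For a compatible couple of Banach spaces $(X_0,X_1)$ (such as a couple of the spaces above, inside the space of measurable functions), let $\mathcal{G}(X_0,X_1)$ be the set of all continuous $G:\overline S\to X_0+X_1$ that are holomorphic in $S$, satisfy $\sup_{z\in\overline S}\frac{\|G(z)\|_{X_0+X_1}}{1+|z|}<\infty$, and are such that for $k=0,1$ the function $t\in\mathbb{R}\mapsto G(k+it)$ takes its values in $X_k$ and is Lipschitz continuous for the norm of $X_k$. For $\theta\in(0,1)$ the second complex interpolation space is $[X_0,X_1]^\theta:=\{G'(\theta):G\in\mathcal{G}(X_0,X_1)\}$. **Theorem 1.3.** Let $\theta\in(0,1)$, $1\le q_0\le p_0<\infty$, $1\le q_1\le p_1<\infty$, $\frac{p_0}{q_0}=\frac{p_1}{q_1}$ and $q_0\ne q_1$, and define $p$ and $q$ by $$\frac1p=\frac{1-\theta}{p_0}+\frac{\theta}{p_1},\qquad \frac1q=\frac{1-\theta}{q_0}+\frac{\theta}{q_1}.$$ Then, as sets of functions, $$[V_0\mathcal{M}^{p_0}_{q_0},V_0\mathcal{M}^{p_1}_{q_1}]^\theta=\mathcal{M}^p_q,$$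 $$[V_\infty\mathcal{M}^{p_0}_{q_0},V_\infty\mathcal{M}^{p_1}_{q_1}]^\theta=\{f\in\mathcal{M}^p_q:\chi_{\{a\le|f|\le b\}}f\in V_\infty\mathcal{M}^p_q\ \text{for all}\ 0<a<b<\infty\},$$ $$[V^{(*)}\mathcal{M}^{p_0}_{q_0},V^{(*)}\mathcal{M}^{p_1}_{q_1}]^\theta=\{f\in\mathcal{M}^p_q:\chi_{\{a\le|f|\le b\}}f\in V^{(*)}\mathcal{M}^p_q\ \text{for all}\ 0<a<b<\infty\}.$$ -/

import Mathlib

open MeasureTheory Filter Topology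
open scoped ENNReal NNReal

noncomputable section

/-! ### The second complex interpolation method -/

/-- A complex normed space that is realized as a linear subspace of an ambient vector space `Z`.
The norm `nrm` is written as a function on `Z` with values in `[0, ∞]`; only its values on
`carrier`, where it is finite, have a meaning. -/
structure NormedSubspace (Z : Type*) [AddCommGroup Z] [Module ℂ Z] where
  carrier : Submodule ℂ Z
  nrm : Z → ℝ≥0∞
  nrm_lt_top : ∀ x ∈ carrier, nrm x < ∞
  nrm_add_le : ∀ x ∈ carrier, ∀ y ∈ carrier, nrm (x + y) ≤ nrm x + nrm y
  nrm_smul : ∀ (c : ℂ), ∀ x ∈ carrier, nrm (c • x) = ‖c‖ₑ * nrm x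
  eq_zero_of_nrm : ∀ x ∈ carrier, nrm x = 0 → x = 0

namespace NormedSubspace

variable {Z : Type*} [AddCommGroup Z] [Module ℂ Z]

/-- A linear subspace of a normed space, with the same norm. -/
def restrict (X : NormedSubspace Z) (S : Submodule ℂ Z) (h : S ≤ X.carrier) :
    NormedSubspace Z where
  carrier := S
  nrm := X.nrm
  nrm_lt_top x hx := X.nrm_lt_top x (h hx)
  nrm_add_le x hx y hy := X.nrm_add_le x (h hx) y (h hy)
  nrm_smul c x hx := X.nrm_smul c x (h hx)
  eq_zero_of_nrm x hx := X.eq_zero_of_nrm x (h hx)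

/-- The norm of `X₀ + X₁`: the infimum of `‖x₀‖ + ‖x₁‖` over all decompositions `z = x₀ + x₁`
with `x₀ ∈ X₀` and `x₁ ∈ X₁`. It is `∞` if `z ∉ X₀ + X₁`. -/
def sumNorm (X₀ X₁ : NormedSubspace Z) (z : Z) : ℝ≥0∞ :=
  ⨅ (x₀ : Z) (_ : x₀ ∈ X₀.carrier) (x₁ : Z) (_ : x₁ ∈ X₁.carrier) (_ : x₀ + x₁ = z),
    X₀.nrm x₀ + X₁.nrm x₁

end NormedSubspace

/-- The open strip `S = {z : 0 < Re z < 1}`. -/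
def openStrip : Set ℂ := {z | 0 < z.re ∧ z.re < 1}

/-- The closure of the strip, `{z : 0 ≤ Re z ≤ 1}`. -/
def closedStrip : Set ℂ := {z | 0 ≤ z.re ∧ z.re ≤ 1}

section Interpolation

variable {Z : Type*} [AddCommGroup Z] [Module ℂ Z]

/-- `g` is an element of `X₀ + X₁` and is the complex derivative of `G` at `z`, the limit of the
difference quotients being taken in the norm of `X₀ + X₁`. -/
def HasSumDerivAt (X₀ X₁ : NormedSubspace Z) (G : ℂ → Z) (g : Z) (z : ℂ) : Prop :=
  g ∈ X₀.carrier ⊔ X₁.carrier ∧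
    Tendsto (fun w : ℂ => X₀.sumNorm X₁ ((w - z)⁻¹ • (G w - G z) - g)) (𝓝[≠] z) (𝓝 0)

/-- The function `t ↦ g t` takes its values in `X` and belongs to `Lip(ℝ, X)`. -/
def IsLip (X : NormedSubspace Z) (g : ℝ → Z) : Prop :=
  (∀ t, g t ∈ X.carrier) ∧ ∃ L : ℝ≥0, ∀ s t : ℝ, X.nrm (g s - g t) ≤ L * ‖s - t‖ₑ

/-- The class `𝒢(X₀, X₁)`. Only the values of `G` on the closed strip are used. -/
structure MemG (X₀ X₁ : NormedSubspace Z) (G : ℂ → Z) : Prop where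
  mem_sum : ∀ z ∈ closedStrip, G z ∈ X₀.carrier ⊔ X₁.carrier
  continuousOn : ∀ z ∈ closedStrip,
    Tendsto (fun w => X₀.sumNorm X₁ (G w - G z)) (𝓝[closedStrip] z) (𝓝 0)
  holomorphicOn : ∀ z ∈ openStrip, ∃ g : Z, HasSumDerivAt X₀ X₁ G g z
  growth : ∃ C : ℝ≥0, ∀ z ∈ closedStrip, X₀.sumNorm X₁ (G z) ≤ C * (1 + ‖z‖ₑ)
  lip_zero : IsLip X₀ (fun t : ℝ => G (t * Complex.I))
  lip_one : IsLip X₁ (fun t : ℝ => G (1 + t * Complex.I))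

/-- The second complex interpolation space `[X₀, X₁]^θ = {G'(θ) : G ∈ 𝒢(X₀, X₁)}`. -/
def secondInterp (X₀ X₁ : NormedSubspace Z) (θ : ℝ) : Set Z :=
  {f | ∃ G : ℂ → Z, MemG X₀ X₁ G ∧ HasSumDerivAt X₀ X₁ G f (θ : ℂ)}

end Interpolation

/-! ### Morrey spaces and vanishing Morrey spaces -/

/-- Complex-valued measurable functions on `ℝⁿ` modulo equality almost everywhere, the ambient
space of all function spaces below. -/
abbrev FunClass (n : ℕ) : Type := EuclideanSpace ℝ (Fin n) →ₘ[volume] ℂ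

/-- `m(f,p,q;r) = sup_x |B(x,r)|^{1/p} (|B(x,r)|⁻¹ ∫_{B(x,r)} |f|^q)^{1/q}`, in `[0, ∞]`. -/
def morreyM {n : ℕ} (f : FunClass n) (p q r : ℝ) : ℝ≥0∞ :=
  ⨆ x : EuclideanSpace ℝ (Fin n),
    volume (Metric.ball x r) ^ (1 / p) *
      ((volume (Metric.ball x r))⁻¹ * ∫⁻ y in Metric.ball x r, ‖f y‖ₑ ^ q) ^ (1 / q)

/-- The Morrey norm `sup_{r > 0} m(f,p,q;r)`, in `[0, ∞]`. -/
def morreyNorm {n : ℕ} (p q : ℝ) (f : FunClass n) : ℝ≥0∞ :=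
  ⨆ (r : ℝ) (_ : 0 < r), morreyM f p q r

/-- `f ∈ M^p_q`. Finiteness of the norm includes that `f` is in `L^q_loc`. -/
def MemMorrey {n : ℕ} (p q : ℝ) (f : FunClass n) : Prop := morreyNorm p q f < ∞

/-- `f ∈ V_0 M^p_q`. -/
def MemVZero {n : ℕ} (p q : ℝ) (f : FunClass n) : Prop :=
  MemMorrey p q f ∧ Tendsto (fun r : ℝ => morreyM f p q r) (𝓝[>] 0) (𝓝 0)

/-- `f ∈ V_∞ M^p_q`. -/
def MemVInfty {n : ℕ} (p q : ℝ) (f : FunClass n) : Prop :=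
  MemMorrey p q f ∧ Tendsto (fun r : ℝ => morreyM f p q r) atTop (𝓝 0)

/-- `sup_x ∫_{B(x,1)} |f|^q χ_{ℝⁿ \ B(0,N)}`. -/
def farMass {n : ℕ} (f : FunClass n) (q N : ℝ) : ℝ≥0∞ :=
  ⨆ x : EuclideanSpace ℝ (Fin n),
    ∫⁻ y in Metric.ball x 1, (Metric.ball 0 N)ᶜ.indicator (fun y => ‖f y‖ₑ ^ q) y

/-- `f ∈ V^{(*)} M^p_q`. -/
def MemVStar {n : ℕ} (p q : ℝ) (f : FunClass n) : Prop :=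
  MemMorrey p q f ∧ Tendsto (fun N : ℝ => farMass f q N) atTop (𝓝 0)

/-- The truncation `χ_{a ≤ |f| ≤ b} f`. -/
def truncation {n : ℕ} (a b : ℝ) (f : FunClass n) : FunClass n :=
  AEEqFun.mk ({y | a ≤ ‖f y‖ ∧ ‖f y‖ ≤ b}.indicator f)
    (f.stronglyMeasurable.indicator
      ((measurableSet_le measurable_const f.stronglyMeasurable.norm.measurable).inter
        (measurableSet_le f.stronglyMeasurable.norm.measurable
          measurable_const))).aestronglyMeasurable

/-! Facts showing that these are normed spaces. -/

section Facts

variable {n : ℕ} {p q : ℝ}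

lemma morreyM_add_le (hq : 1 ≤ q) (f g : FunClass n) (r : ℝ) :
    morreyM (f + g) p q r ≤ morreyM f p q r + morreyM g p q r := by
  have hq0 : 0 ≤ 1 / q := by positivity
  refine iSup_le fun x => ?_
  refine le_trans ?_ (add_le_add (le_iSup _ x) (le_iSup _ x))
  rw [← mul_add]
  gcongr
  rw [ENNReal.mul_rpow_of_nonneg _ _ hq0, ENNReal.mul_rpow_of_nonneg _ _ hq0,
    ENNReal.mul_rpow_of_nonneg _ _ hq0, ← mul_add]
  gcongr
  have h1 : ∫⁻ y in Metric.ball x r, ‖(f + g) y‖ₑ ^ q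
      ≤ ∫⁻ y in Metric.ball x r, ((fun y => ‖f y‖ₑ) + fun y => ‖g y‖ₑ) y ^ q := by
    apply lintegral_mono_ae
    filter_upwards [ae_restrict_of_ae (AEEqFun.coeFn_add f g)] with y hy
    rw [hy]
    exact ENNReal.rpow_le_rpow (enorm_add_le _ _) (by linarith)
  refine (ENNReal.rpow_le_rpow h1 hq0).trans ?_
  exact ENNReal.lintegral_Lp_add_le f.stronglyMeasurable.enorm.aemeasurable
    g.stronglyMeasurable.enorm.aemeasurable hq

lemma morreyM_smul (hq : 1 ≤ q) (c : ℂ) (f : FunClass n) (r : ℝ) :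
    morreyM (c • f) p q r = ‖c‖ₑ * morreyM f p q r := by
  have hq0 : 0 ≤ 1 / q := by positivity
  have hqp : 0 < q := by linarith
  unfold morreyM
  rw [ENNReal.mul_iSup]
  congr 1
  funext x
  have h1 : ∫⁻ y in Metric.ball x r, ‖(c • f) y‖ₑ ^ q
      = ‖c‖ₑ ^ q * ∫⁻ y in Metric.ball x r, ‖f y‖ₑ ^ q := by
    rw [← lintegral_const_mul' _ _ (by simp [hqp.le])]
    apply lintegral_congr_ae
    filter_upwards [ae_restrict_of_ae (AEEqFun.coeFn_smul c f)] with y hy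
    rw [hy, Pi.smul_apply, enorm_smul, ENNReal.mul_rpow_of_nonneg _ _ hqp.le]
  rw [h1, mul_left_comm _ (‖c‖ₑ ^ q), ENNReal.mul_rpow_of_nonneg _ _ hq0, ← ENNReal.rpow_mul,
    mul_one_div_cancel hqp.ne', ENNReal.rpow_one, mul_left_comm]

lemma morreyNorm_add_le (hq : 1 ≤ q) (f g : FunClass n) :
    morreyNorm p q (f + g) ≤ morreyNorm p q f + morreyNorm p q g :=
  iSup₂_le fun r hr => (morreyM_add_le hq f g r).trans
    (add_le_add (le_iSup₂_of_le r hr le_rfl) (le_iSup₂_of_le r hr le_rfl))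

lemma morreyNorm_smul (hq : 1 ≤ q) (c : ℂ) (f : FunClass n) :
    morreyNorm p q (c • f) = ‖c‖ₑ * morreyNorm p q f := by
  unfold morreyNorm
  simp_rw [morreyM_smul hq, ENNReal.mul_iSup]

lemma morreyM_zero (hq : 1 ≤ q) (r : ℝ) : morreyM (0 : FunClass n) p q r = 0 := by
  have h := morreyM_smul (p := p) hq 0 (0 : FunClass n) r
  have hz : (0 : ℂ) • (0 : FunClass n) = 0 := zero_smul ℂ (0 : FunClass n)
  rw [hz, enorm_zero, zero_mul] at h
  exact h

lemma morreyNorm_zero (hq : 1 ≤ q) : morreyNorm p q (0 : FunClass n) = 0 := by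
  simp [morreyNorm, morreyM_zero hq]

lemma eq_zero_of_morreyNorm (hq : 1 ≤ q) (f : FunClass n) (h : morreyNorm p q f = 0) :
    f = 0 := by
  have hqp : 0 < q := by linarith
  have key : ∀ r : ℝ, 0 < r → ∀ᵐ y, y ∈ Metric.ball (0 : EuclideanSpace ℝ (Fin n)) r → f y = 0 := by
    intro r hr
    have h1 : morreyM f p q r = 0 :=
      le_antisymm ((le_iSup₂_of_le (f := fun (r : ℝ) (_ : 0 < r) => morreyM f p q r)
        r hr le_rfl).trans h.le) zero_le
    have h2 := (iSup_eq_bot.1 h1) (0 : EuclideanSpace ℝ (Fin n))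
    have hpos : 0 < volume (Metric.ball (0 : EuclideanSpace ℝ (Fin n)) r) :=
      Metric.measure_ball_pos _ _ hr
    have hfin : volume (Metric.ball (0 : EuclideanSpace ℝ (Fin n)) r) ≠ ∞ :=
      measure_ball_lt_top.ne
    rw [ENNReal.bot_eq_zero, mul_eq_zero] at h2
    rcases h2 with h2 | h2
    · exact absurd h2 (ENNReal.rpow_pos hpos hfin).ne'
    · rw [ENNReal.rpow_eq_zero_iff_of_pos (by positivity), mul_eq_zero] at h2
      rcases h2 with h2 | h2
      · exact absurd h2 (ENNReal.inv_ne_zero.2 hfin)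
      · rw [lintegral_eq_zero_iff (f.stronglyMeasurable.enorm.pow_const q)] at h2
        have h3 := (ae_restrict_iff' measurableSet_ball).1 h2
        filter_upwards [h3] with y hy hyr
        have := hy hyr
        simpa [ENNReal.rpow_eq_zero_iff_of_pos hqp] using this
  apply AEEqFun.ext
  have hall : ∀ᵐ y, ∀ k : ℕ,
      y ∈ Metric.ball (0 : EuclideanSpace ℝ (Fin n)) ((k : ℝ) + 1) → f y = 0 :=
    ae_all_iff.2 fun k => key _ (by positivity)
  filter_upwards [hall, AEEqFun.coeFn_zero (α := EuclideanSpace ℝ (Fin n)) (β := ℂ)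
    (μ := volume)] with y hy h0
  rw [h0]
  obtain ⟨k, hk⟩ := exists_nat_gt ‖y‖
  exact hy k (by rw [mem_ball_zero_iff]; linarith)

lemma farMass_add_le (hq : 1 ≤ q) (f g : FunClass n) (N : ℝ) :
    farMass (f + g) q N ≤ 2 ^ (q - 1) * (farMass f q N + farMass g q N) := by
  refine iSup_le fun x => ?_
  have hle : ∀ h : FunClass n, ∫⁻ y in Metric.ball x 1,
      (Metric.ball 0 N)ᶜ.indicator (fun y => ‖h y‖ₑ ^ q) y ≤ farMass h q N := fun h =>
    le_iSup (fun x : EuclideanSpace ℝ (Fin n) => ∫⁻ y in Metric.ball x 1,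
      (Metric.ball 0 N)ᶜ.indicator (fun y => ‖h y‖ₑ ^ q) y) x
  refine le_trans ?_ (mul_le_mul_right (add_le_add (hle f) (hle g)) _)
  have hm : Measurable ((Metric.ball (0 : EuclideanSpace ℝ (Fin n)) N)ᶜ.indicator
      (fun y => ‖f y‖ₑ ^ q)) :=
    (f.stronglyMeasurable.enorm.pow_const q).indicator measurableSet_ball.compl
  rw [← lintegral_add_left hm, ← lintegral_const_mul' _ _ (by simp)]
  apply lintegral_mono_ae
  filter_upwards [ae_restrict_of_ae (AEEqFun.coeFn_add f g)] with y hy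
  by_cases hyN : y ∈ (Metric.ball (0 : EuclideanSpace ℝ (Fin n)) N)ᶜ
  · simp only [Set.indicator_of_mem hyN]
    rw [hy]
    exact (ENNReal.rpow_le_rpow (enorm_add_le _ _) (by linarith)).trans
      (ENNReal.rpow_add_le_mul_rpow_add_rpow _ _ hq)
  · simp only [Set.indicator_of_notMem hyN]
    exact zero_le

lemma farMass_smul (hq : 1 ≤ q) (c : ℂ) (f : FunClass n) (N : ℝ) :
    farMass (c • f) q N = ‖c‖ₑ ^ q * farMass f q N := by
  have hqp : 0 < q := by linarith
  unfold farMass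
  rw [ENNReal.mul_iSup]
  congr 1
  funext x
  rw [← lintegral_const_mul' _ _ (by simp [hqp.le])]
  apply lintegral_congr_ae
  filter_upwards [ae_restrict_of_ae (AEEqFun.coeFn_smul c f)] with y hy
  by_cases hyN : y ∈ (Metric.ball (0 : EuclideanSpace ℝ (Fin n)) N)ᶜ
  · simp only [Set.indicator_of_mem hyN]
    rw [hy, Pi.smul_apply, enorm_smul, ENNReal.mul_rpow_of_nonneg _ _ hqp.le]
  · simp only [Set.indicator_of_notMem hyN, mul_zero]

lemma tendsto_morreyM_add (hq : 1 ≤ q) {l : Filter ℝ} {f g : FunClass n}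
    (hf : Tendsto (fun r => morreyM f p q r) l (𝓝 0))
    (hg : Tendsto (fun r => morreyM g p q r) l (𝓝 0)) :
    Tendsto (fun r => morreyM (f + g) p q r) l (𝓝 0) := by
  have h := hf.add hg
  rw [add_zero] at h
  exact tendsto_of_tendsto_of_tendsto_of_le_of_le tendsto_const_nhds h
    (fun _ => zero_le) (fun r => morreyM_add_le hq f g r)

lemma tendsto_morreyM_smul (hq : 1 ≤ q) {l : Filter ℝ} (c : ℂ) {f : FunClass n}
    (hf : Tendsto (fun r => morreyM f p q r) l (𝓝 0)) :
    Tendsto (fun r => morreyM (c • f) p q r) l (𝓝 0) := by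
  simp_rw [morreyM_smul hq]
  simpa using ENNReal.Tendsto.const_mul hf (Or.inr (enorm_ne_top (x := c)))

lemma MemMorrey.add (hq : 1 ≤ q) {f g : FunClass n} (hf : MemMorrey p q f)
    (hg : MemMorrey p q g) : MemMorrey p q (f + g) :=
  (morreyNorm_add_le hq f g).trans_lt (ENNReal.add_lt_top.2 ⟨hf, hg⟩)

lemma MemMorrey.smul (hq : 1 ≤ q) (c : ℂ) {f : FunClass n} (hf : MemMorrey p q f) :
    MemMorrey p q (c • f) := by
  unfold MemMorrey
  rw [morreyNorm_smul hq]
  exact ENNReal.mul_lt_top enorm_lt_top hf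

lemma MemMorrey.zero (hq : 1 ≤ q) : MemMorrey p q (0 : FunClass n) := by
  unfold MemMorrey
  rw [morreyNorm_zero hq]
  exact ENNReal.zero_lt_top

end Facts

/-- The Morrey space `M^p_q(ℝⁿ)` with its norm. -/
def morreySpace (n : ℕ) (p q : ℝ) (hq : 1 ≤ q) : NormedSubspace (FunClass n) where
  carrier :=
    { carrier := {f | MemMorrey p q f}
      add_mem' := fun hf hg => hf.add hq hg
      zero_mem' := MemMorrey.zero hq
      smul_mem' := fun c _ hf => hf.smul hq c }
  nrm := morreyNorm p q
  nrm_lt_top _ hf := hf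
  nrm_add_le f _ g _ := morreyNorm_add_le hq f g
  nrm_smul c f _ := morreyNorm_smul hq c f
  eq_zero_of_nrm f _ h := eq_zero_of_morreyNorm hq f h

/-- `V_0 M^p_q(ℝⁿ)` with the norm of `M^p_q(ℝⁿ)`. -/
def vZero (n : ℕ) (p q : ℝ) (hq : 1 ≤ q) : NormedSubspace (FunClass n) :=
  (morreySpace n p q hq).restrict
    { carrier := {f | MemVZero p q f}
      add_mem' := fun hf hg => ⟨hf.1.add hq hg.1, tendsto_morreyM_add hq hf.2 hg.2⟩
      zero_mem' := ⟨MemMorrey.zero hq, by simp_rw [morreyM_zero hq]; exact tendsto_const_nhds⟩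
      smul_mem' := fun c _ hf => ⟨hf.1.smul hq c, tendsto_morreyM_smul hq c hf.2⟩ }
    (fun _ hf => hf.1)

/-- `V_∞ M^p_q(ℝⁿ)` with the norm of `M^p_q(ℝⁿ)`. -/
def vInfty (n : ℕ) (p q : ℝ) (hq : 1 ≤ q) : NormedSubspace (FunClass n) :=
  (morreySpace n p q hq).restrict
    { carrier := {f | MemVInfty p q f}
      add_mem' := fun hf hg => ⟨hf.1.add hq hg.1, tendsto_morreyM_add hq hf.2 hg.2⟩
      zero_mem' := ⟨MemMorrey.zero hq, by simp_rw [morreyM_zero hq]; exact tendsto_const_nhds⟩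
      smul_mem' := fun c _ hf => ⟨hf.1.smul hq c, tendsto_morreyM_smul hq c hf.2⟩ }
    (fun _ hf => hf.1)

/-- `V^{(*)} M^p_q(ℝⁿ)` with the norm of `M^p_q(ℝⁿ)`. -/
def vStar (n : ℕ) (p q : ℝ) (hq : 1 ≤ q) : NormedSubspace (FunClass n) :=
  (morreySpace n p q hq).restrict
    { carrier := {f | MemVStar p q f}
      add_mem' := fun {f g} hf hg => ⟨hf.1.add hq hg.1, by
        have h := ENNReal.Tendsto.const_mul (hf.2.add hg.2)
          (Or.inr (show (2 : ℝ≥0∞) ^ (q - 1) ≠ ∞ by simp))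
        rw [add_zero, mul_zero] at h
        exact tendsto_of_tendsto_of_tendsto_of_le_of_le tendsto_const_nhds h
          (fun _ => zero_le) (fun N => farMass_add_le hq f g N)⟩
      zero_mem' := ⟨MemMorrey.zero hq, by
        have h : ∀ N, farMass (0 : FunClass n) q N = 0 := fun N => by
          have h := farMass_smul hq 0 (0 : FunClass n) N
          have hz : (0 : ℂ) • (0 : FunClass n) = 0 := zero_smul ℂ (0 : FunClass n)
          rw [hz, enorm_zero, ENNReal.zero_rpow_of_pos (by linarith), zero_mul] at h
          exact h
        simp_rw [h]
        exact tendsto_const_nhds⟩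
      smul_mem' := fun c f hf => ⟨hf.1.smul hq c, by
        simp_rw [farMass_smul hq]
        have h := ENNReal.Tendsto.const_mul hf.2
          (Or.inr (show ‖c‖ₑ ^ q ≠ ∞ by simp [show 0 ≤ q by linarith]))
        rwa [mul_zero] at h⟩ }
    (fun _ hf => hf.1)

end

/-!
All conditions on `f` involve only `|f|^q` and the ratio `σ = q/p`, which is the same for the three
pairs of exponents. A function lies in one of the vanishing spaces if and only if it lies in the
Morrey space and a quantity `sup_x c_i(x) ∫_{S_i(x)} |f|^q` tends to zero along a filter, with
weights and sets that do not depend on `q` (`IsVanishingMorrey`). For every such family,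
`mem_secondInterp_iff` identifies the interpolation space with the set of all Morrey functions
whose truncations satisfy the vanishing condition. For `V_0` the condition on the truncations is
automatic, since a truncation is bounded.

Let `f = G'(θ)` with `G` in the class `𝒢`. By definition `f = f₀ + f₁` with `f_k` in the two
vanishing spaces, and `{|f| ≥ a}` is contained in `{|f₀| ≥ a/2} ∪ {|f₁| ≥ a/2}`; this gives the
vanishing of the truncations (`tendsto_supMass_truncation`). That `f` is a Morrey function follows
from duality on each ball: the difference quotients of `G` in the imaginary direction are bounded
by the Lipschitz constants on the two boundary lines, and pairing them with the analytic family
dual to `L^q` and using the three lines theorem bounds the `L^q` norm of `f` on the ball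
(`enorm_pairing_le`, `morreyMass_lt_top_of_hasSumDerivAt`). The dual functions are taken to be step
functions, constant on the sets where `⌊log |f|⌋` is constant; this loses a factor `e` but makes
holomorphy of the pairing a statement about finite sums.

Conversely, for a Morrey function `f` put `F(ζ) = sgn(f) |f|^{(1-ζ)q/q₀ + ζq/q₁}`, and let `G` be a
primitive of `F`, with base point `1` where `|F(1)| ≤ |F(0)|` and base point `0` elsewhere; then
`G'(θ) = F(θ) = f`. With these base points, `G` splits into a part bounded by `|f|^{q/q₀}` and a
part bounded by `|f|^{q/q₁}`, and on each boundary line both parts are bounded by the right power.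
Integration in `ζ` also gains a factor `1/|log |f||`. Hence the values of `G` are limits, in
Morrey norm, of functions carried by sets `{a ≤ |f| ≤ b}`, where only the truncations of `f` matter
(`mem_of_log_decay`, `mem_secondInterp`).
-/

noncomputable section

variable {n : ℕ}

/-! ### Morrey norms as suprema of weighted integrals -/

/-- The supremum over `x` of `c x · ∫_{S x} φ`, for a weight `c` and a family of sets `S` indexed by
the centre `x`. Both `r ↦ m(f,p,q;r)^q` and `N ↦ farMass f q N` are of this form with `φ = |f|^q`,
which is why the three vanishing conditions can be treated together. -/
def supMass (c : EuclideanSpace ℝ (Fin n) → ℝ≥0∞)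
    (S : EuclideanSpace ℝ (Fin n) → Set (EuclideanSpace ℝ (Fin n)))
    (φ : EuclideanSpace ℝ (Fin n) → ℝ≥0∞) : ℝ≥0∞ :=
  ⨆ x, c x * ∫⁻ y in S x, φ y

section SupMass

variable {c : EuclideanSpace ℝ (Fin n) → ℝ≥0∞}
  {S : EuclideanSpace ℝ (Fin n) → Set (EuclideanSpace ℝ (Fin n))}
  {φ ψ : EuclideanSpace ℝ (Fin n) → ℝ≥0∞}

lemma supMass_mono_ae (h : ∀ᵐ y, φ y ≤ ψ y) : supMass c S φ ≤ supMass c S ψ :=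
  iSup_mono fun _ => mul_le_mul_right (lintegral_mono_ae (ae_restrict_of_ae h)) _

lemma supMass_add_le (hφ : Measurable φ) :
    supMass c S (fun y => φ y + ψ y) ≤ supMass c S φ + supMass c S ψ := by
  refine iSup_le fun x => ?_
  rw [lintegral_add_left hφ, mul_add]
  exact add_le_add (le_iSup (fun x => c x * ∫⁻ y in S x, φ y) x)
    (le_iSup (fun x => c x * ∫⁻ y in S x, ψ y) x)

lemma supMass_const_mul {a : ℝ≥0∞} (ha : a ≠ ∞) :
    supMass c S (fun y => a * φ y) = a * supMass c S φ := by
  unfold supMass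
  rw [ENNReal.mul_iSup]
  congr 1
  funext x
  rw [lintegral_const_mul' _ _ ha, mul_left_comm]

end SupMass

/-- `sup_x |B(x,r)|^{σ-1} ∫_{B(x,r)} φ`. For `σ = q/p` and `φ = |f|^q` this is `m(f,p,q;r)^q`
(`morreyM_eq`). It depends on `p` and `q` through `q/p` only, the common value of the three pairs
of exponents in the interpolation theorem. -/
def ballMass (σ r : ℝ) (φ : EuclideanSpace ℝ (Fin n) → ℝ≥0∞) : ℝ≥0∞ :=
  supMass (fun x => volume (Metric.ball x r) ^ (σ - 1)) (fun x => Metric.ball x r) φ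

/-- `sup_{r>0} ballMass σ r φ`; for `σ = q/p` and `φ = |f|^q` it is the `q`-th power of the Morrey
norm (`morreyNorm_eq`). -/
def morreyMass (σ : ℝ) (φ : EuclideanSpace ℝ (Fin n) → ℝ≥0∞) : ℝ≥0∞ :=
  ⨆ (r : ℝ) (_ : 0 < r), ballMass σ r φ

lemma iSup_rpow {ι : Sort*} {t : ℝ} (ht : 0 < t) (u : ι → ℝ≥0∞) :
    (⨆ i, u i) ^ t = ⨆ i, u i ^ t :=
  (ENNReal.orderIsoRpow t ht).map_iSup u

lemma morreyM_eq {p q σ r : ℝ} (hp : 0 < p) (hq : 0 < q) (hσ : q / p = σ) (hr : 0 < r)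
    (f : FunClass n) :
    morreyM f p q r = ballMass σ r (fun y => ‖f y‖ₑ ^ q) ^ (1 / q) := by
  unfold morreyM ballMass supMass
  rw [iSup_rpow (by positivity)]
  congr 1
  funext x
  have h0 : volume (Metric.ball x r) ≠ 0 := (Metric.measure_ball_pos _ _ hr).ne'
  have h1 : volume (Metric.ball x r) ≠ ∞ := measure_ball_lt_top.ne
  rw [ENNReal.mul_rpow_of_nonneg _ _ (by positivity),
    ENNReal.mul_rpow_of_nonneg _ _ (by positivity),
    ← ENNReal.rpow_neg_one, ← ENNReal.rpow_mul, ← ENNReal.rpow_mul, ← mul_assoc,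
    ← ENNReal.rpow_add _ _ h0 h1]
  congr 2
  rw [← hσ]
  field_simp
  ring

lemma morreyNorm_eq {p q σ : ℝ} (hp : 0 < p) (hq : 0 < q) (hσ : q / p = σ) (f : FunClass n) :
    morreyNorm p q f = morreyMass σ (fun y => ‖f y‖ₑ ^ q) ^ (1 / q) := by
  unfold morreyNorm morreyMass
  rw [iSup_rpow (by positivity)]
  congr 1
  funext r
  rw [iSup_rpow (by positivity)]
  congr 1
  funext hr
  exact morreyM_eq hp hq hσ hr f

lemma memMorrey_iff {p q σ : ℝ} (hp : 0 < p) (hq : 0 < q) (hσ : q / p = σ) (f : FunClass n) :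
    MemMorrey p q f ↔ morreyMass σ (fun y => ‖f y‖ₑ ^ q) < ∞ := by
  unfold MemMorrey
  rw [morreyNorm_eq hp hq hσ, ENNReal.rpow_lt_top_iff_of_pos (by positivity)]

lemma morreyMass_mono_ae {σ : ℝ} {φ ψ : EuclideanSpace ℝ (Fin n) → ℝ≥0∞}
    (h : ∀ᵐ y, φ y ≤ ψ y) : morreyMass σ φ ≤ morreyMass σ ψ :=
  iSup₂_mono fun _ _ => supMass_mono_ae h

lemma morreyMass_const_mul {σ : ℝ} {φ : EuclideanSpace ℝ (Fin n) → ℝ≥0∞} {a : ℝ≥0∞}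
    (ha : a ≠ ∞) : morreyMass σ (fun y => a * φ y) = a * morreyMass σ φ := by
  unfold morreyMass ballMass
  simp_rw [supMass_const_mul ha, ENNReal.mul_iSup]

lemma lintegral_ball_le_morreyMass {σ r : ℝ} (hr : 0 < r) (x : EuclideanSpace ℝ (Fin n))
    (φ : EuclideanSpace ℝ (Fin n) → ℝ≥0∞) :
    ∫⁻ y in Metric.ball x r, φ y ≤ volume (Metric.ball x r) ^ (1 - σ) * morreyMass σ φ := by
  have h0 : volume (Metric.ball x r) ≠ 0 := (Metric.measure_ball_pos _ _ hr).ne'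
  have h1 : volume (Metric.ball x r) ≠ ∞ := measure_ball_lt_top.ne
  have h : volume (Metric.ball x r) ^ (σ - 1) * ∫⁻ y in Metric.ball x r, φ y
      ≤ morreyMass σ φ :=
    le_iSup₂_of_le r hr (le_iSup (fun x => volume (Metric.ball x r) ^ (σ - 1) *
      ∫⁻ y in Metric.ball x r, φ y) x)
  calc ∫⁻ y in Metric.ball x r, φ y
      = volume (Metric.ball x r) ^ (1 - σ) *
        (volume (Metric.ball x r) ^ (σ - 1) * ∫⁻ y in Metric.ball x r, φ y) := by
        rw [← mul_assoc, ← ENNReal.rpow_add _ _ h0 h1]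
        simp
    _ ≤ _ := by gcongr

lemma enorm_rpow_le_of_norm_le {q q' α : ℝ} (hq' : 0 < q') (hα : 0 < α) (hαq : α * q' = q)
    {C : ℝ≥0} {w u : ℂ} (h : ‖w‖ ≤ C * ‖u‖ ^ α) :
    ‖w‖ₑ ^ q' ≤ (C : ℝ≥0∞) ^ q' * ‖u‖ₑ ^ q := by
  have h1 : ‖w‖ₑ ≤ C * ‖u‖ₑ ^ α := by
    rw [← ofReal_norm, ← ofReal_norm,
      ENNReal.ofReal_rpow_of_nonneg (norm_nonneg _) hα.le, ← ENNReal.ofReal_coe_nnreal,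
      ← ENNReal.ofReal_mul C.coe_nonneg]
    exact ENNReal.ofReal_le_ofReal h
  refine (ENNReal.rpow_le_rpow h1 hq'.le).trans ?_
  rw [ENNReal.mul_rpow_of_nonneg _ _ hq'.le, ← ENNReal.rpow_mul, hαq]

lemma morreyNorm_le_of_norm_le {p' q q' σ α : ℝ} (hp' : 0 < p') (hq' : 0 < q')
    (hσ' : q' / p' = σ) (hα : 0 < α) (hαq : α * q' = q) {f F : FunClass n} {C : ℝ≥0}
    (h : ∀ᵐ y, ‖F y‖ ≤ C * ‖f y‖ ^ α) :
    morreyNorm p' q' F ≤ C * morreyMass σ (fun y => ‖f y‖ₑ ^ q) ^ (1 / q') := by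
  rw [morreyNorm_eq hp' hq' hσ']
  have h1 := morreyMass_mono_ae (σ := σ)
    (h.mono fun y hy => enorm_rpow_le_of_norm_le hq' hα hαq hy)
  rw [morreyMass_const_mul (by simp [hq'.le])] at h1
  refine (ENNReal.rpow_le_rpow h1 (by positivity)).trans ?_
  rw [ENNReal.mul_rpow_of_nonneg _ _ (by positivity), ← ENNReal.rpow_mul,
    mul_one_div_cancel hq'.ne', ENNReal.rpow_one]

/-! ### The three lines theorem and functionals on the sum space -/

lemma isOpen_openStrip : IsOpen openStrip :=
  (isOpen_lt continuous_const Complex.continuous_re).inter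
    (isOpen_lt Complex.continuous_re continuous_const)

lemma isClosed_closedStrip : IsClosed closedStrip :=
  (isClosed_le continuous_const Complex.continuous_re).inter
    (isClosed_le Complex.continuous_re continuous_const)

lemma openStrip_subset_closedStrip : openStrip ⊆ closedStrip :=
  fun _ hz => ⟨hz.1.le, hz.2.le⟩

/-- The three lines theorem for functions of linear growth; Phragmén–Lindelöf supplies the
boundedness that Hadamard's theorem needs. -/
lemma norm_le_of_growth_strip {g : ℂ → ℂ} (hc : ContinuousOn g closedStrip)
    (hd : DifferentiableOn ℂ g openStrip) {C : ℝ} (hC : ∀ z ∈ closedStrip, ‖g z‖ ≤ C * (1 + ‖z‖))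
    {a b : ℝ} (ha : ∀ z : ℂ, z.re = 0 → ‖g z‖ ≤ a) (hb : ∀ z : ℂ, z.re = 1 → ‖g z‖ ≤ b)
    {θ : ℝ} (hθ₀ : 0 < θ) (hθ₁ : θ < 1) : ‖g θ‖ ≤ a ^ (1 - θ) * b ^ θ := by
  have hcl : DiffContOnCl ℂ g openStrip :=
    ⟨hd, hc.mono (closure_minimal openStrip_subset_closedStrip isClosed_closedStrip)⟩
  have hC0 : 0 ≤ C := by
    have := (norm_nonneg _).trans (hC 0 (by simp [closedStrip]))
    simpa using this
  have hbdd : ∀ z ∈ closedStrip, ‖g z‖ ≤ max a b := by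
    intro z hz
    refine PhragmenLindelof.vertical_strip (a := 0) (b := 1) hcl ?_
      (fun z hz => (ha z hz).trans (le_max_left _ _))
      (fun z hz => (hb z hz).trans (le_max_right _ _)) hz.1 hz.2
    refine ⟨1, by simpa using (by linarith [Real.pi_gt_three] : (1 : ℝ) < Real.pi), 1, ?_⟩
    refine Asymptotics.IsBigO.of_bound C ?_
    refine Filter.Eventually.filter_mono inf_le_right ?_
    refine Filter.eventually_principal.2 fun z hz => ?_
    refine (hC z ⟨hz.1.le, hz.2.le⟩).trans (mul_le_mul_of_nonneg_left ?_ hC0)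
    rw [Real.norm_of_nonneg (Real.exp_pos _).le, one_mul, one_mul]
    have h1 := Complex.norm_le_abs_re_add_abs_im z
    have h2 : |z.re| ≤ 1 := abs_le.2 ⟨by linarith [hz.1], hz.2.le⟩
    have h3 := Real.add_one_le_exp |z.im|
    have h4 := Real.add_one_le_exp (Real.exp |z.im|)
    linarith
  have h := Complex.HadamardThreeLines.norm_le_interp_of_mem_verticalClosedStrip' (f := g)
    (z := θ) (l := 0) (u := 1) zero_lt_one
    (by simp [Complex.HadamardThreeLines.verticalClosedStrip, hθ₀.le, hθ₁.le]) hcl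
    ⟨max a b, by rintro _ ⟨z, hz, rfl⟩; exact hbdd z hz⟩ ha hb
  simpa using h

section Functional

variable {Z : Type*} [AddCommGroup Z] [Module ℂ Z] {X₀ X₁ : NormedSubspace Z}

/-- `l` restricts to a bounded linear functional on `X₀ + X₁`; its values outside are irrelevant. -/
structure IsSumFunctional (X₀ X₁ : NormedSubspace Z) (l : Z → ℂ) : Prop where
  map_sub : ∀ x ∈ X₀.carrier ⊔ X₁.carrier, ∀ y ∈ X₀.carrier ⊔ X₁.carrier, l (x - y) = l x - l y
  map_smul : ∀ c : ℂ, ∀ x ∈ X₀.carrier ⊔ X₁.carrier, l (c • x) = c * l x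
  bound : ∃ K : ℝ≥0, ∀ x ∈ X₀.carrier ⊔ X₁.carrier, ‖l x‖ₑ ≤ K * X₀.sumNorm X₁ x

namespace IsSumFunctional

variable {l : Z → ℂ} {G : ℂ → Z}

lemma tendsto_zero (hl : IsSumFunctional X₀ X₁ l) {F : Filter ℂ} {u : ℂ → Z}
    (hu : ∀ᶠ w in F, u w ∈ X₀.carrier ⊔ X₁.carrier)
    (h : Tendsto (fun w => X₀.sumNorm X₁ (u w)) F (𝓝 0)) :
    Tendsto (fun w => l (u w)) F (𝓝 0) := by
  obtain ⟨K, hK⟩ := hl.bound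
  rw [tendsto_zero_iff_enorm_tendsto_zero]
  have h1 := ENNReal.Tendsto.const_mul h (Or.inr (ENNReal.coe_ne_top (r := K)))
  rw [mul_zero] at h1
  exact tendsto_of_tendsto_of_tendsto_of_le_of_le' tendsto_const_nhds h1
    (Eventually.of_forall fun _ => zero_le) (hu.mono fun w hw => hK _ hw)

lemma continuousOn (hl : IsSumFunctional X₀ X₁ l) (hG : MemG X₀ X₁ G) :
    ContinuousOn (fun z => l (G z)) closedStrip := by
  intro z hz
  have h := hl.tendsto_zero
    (eventually_mem_nhdsWithin.mono fun w hw => sub_mem (hG.mem_sum w hw) (hG.mem_sum z hz))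
    (hG.continuousOn z hz)
  rw [ContinuousWithinAt, ← tendsto_sub_nhds_zero_iff]
  refine h.congr' ?_
  filter_upwards [eventually_mem_nhdsWithin] with w hw
  exact hl.map_sub _ (hG.mem_sum w hw) _ (hG.mem_sum z hz)

lemma hasDerivAt (hl : IsSumFunctional X₀ X₁ l) (hG : MemG X₀ X₁ G) {g : Z} {z : ℂ}
    (hz : z ∈ openStrip) (h : HasSumDerivAt X₀ X₁ G g z) :
    HasDerivAt (fun z => l (G z)) (l g) z := by
  have hzs := hG.mem_sum z (openStrip_subset_closedStrip hz)
  have hev : ∀ᶠ w in 𝓝[≠] z, G w ∈ X₀.carrier ⊔ X₁.carrier := by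
    filter_upwards [mem_nhdsWithin_of_mem_nhds (isOpen_openStrip.mem_nhds hz)] with w hw
    exact hG.mem_sum w (openStrip_subset_closedStrip hw)
  have h1 := hl.tendsto_zero (hev.mono fun w hw =>
    sub_mem (Submodule.smul_mem _ _ (sub_mem hw hzs)) h.1) h.2
  rw [hasDerivAt_iff_tendsto_slope, ← tendsto_sub_nhds_zero_iff]
  refine h1.congr' ?_
  filter_upwards [hev] with w hw
  rw [hl.map_sub _ (Submodule.smul_mem _ _ (sub_mem hw hzs)) _ h.1,
    hl.map_smul _ _ (sub_mem hw hzs), hl.map_sub _ hw _ hzs, slope_def_module, smul_eq_mul]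

lemma growth (hl : IsSumFunctional X₀ X₁ l) (hG : MemG X₀ X₁ G) :
    ∃ C : ℝ, 0 ≤ C ∧ ∀ z ∈ closedStrip, ‖l (G z)‖ ≤ C * (1 + ‖z‖) := by
  obtain ⟨K, hK⟩ := hl.bound
  obtain ⟨C, hC⟩ := hG.growth
  refine ⟨K * C, by positivity, fun z hz => ?_⟩
  have h := (hK _ (hG.mem_sum z hz)).trans (mul_le_mul_right (hC z hz) _)
  have h2 : ‖l (G z)‖ₑ ≤ ((K * (C * (1 + ‖z‖₊)) : ℝ≥0) : ℝ≥0∞) := by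
    refine h.trans_eq ?_
    push_cast
    rfl
  have h3 : ‖l (G z)‖₊ ≤ K * (C * (1 + ‖z‖₊)) := ENNReal.coe_le_coe.1 h2
  have h4 : ‖l (G z)‖ ≤ K * (C * (1 + ‖z‖)) := by exact_mod_cast h3
  linarith

end IsSumFunctional

end Functional

lemma lintegral_ball_le_morreyNorm {p q σ : ℝ} (hp : 0 < p) (hq : 1 ≤ q) (hσ : q / p = σ)
    {r : ℝ} (hr : 0 < r) (x : EuclideanSpace ℝ (Fin n)) (F : FunClass n) :
    (∫⁻ y in Metric.ball x r, ‖F y‖ₑ ^ q) ^ (1 / q) ≤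
      volume (Metric.ball x r) ^ ((1 - σ) / q) * morreyNorm p q F := by
  have hq0 : 0 < q := by linarith
  rw [morreyNorm_eq hp hq0 hσ]
  refine (ENNReal.rpow_le_rpow (lintegral_ball_le_morreyMass (σ := σ) hr x _)
    (by positivity)).trans ?_
  rw [ENNReal.mul_rpow_of_nonneg _ _ (by positivity), ← ENNReal.rpow_mul, mul_one_div]

lemma lintegral_enorm_ball_le {p q σ : ℝ} (hp : 0 < p) (hq : 1 ≤ q) (hσ : q / p = σ)
    {r : ℝ} (hr : 0 < r) (x : EuclideanSpace ℝ (Fin n)) :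
    ∃ K : ℝ≥0, ∀ F : FunClass n,
      ∫⁻ y in Metric.ball x r, ‖F y‖ₑ ≤ K * morreyNorm p q F := by
  have hq0 : 0 < q := by linarith
  have h0 : volume (Metric.ball x r) ≠ 0 := (Metric.measure_ball_pos _ _ hr).ne'
  have h1 : volume (Metric.ball x r) ≠ ∞ := measure_ball_lt_top.ne
  have hq1 : 0 ≤ 1 - 1 / q := by
    rw [sub_nonneg, div_le_one hq0]; exact hq
  have hK : volume (Metric.ball x r) ^ ((1 - σ) / q) * volume (Metric.ball x r) ^ (1 - 1 / q)
      ≠ ∞ := ENNReal.mul_ne_top (ENNReal.rpow_ne_top_of_ne_zero h0 h1)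
        (ENNReal.rpow_ne_top_of_ne_zero h0 h1)
  refine ⟨(volume (Metric.ball x r) ^ ((1 - σ) / q) *
    volume (Metric.ball x r) ^ (1 - 1 / q)).toNNReal, fun F => ?_⟩
  rw [ENNReal.coe_toNNReal hK]
  have h := ENNReal.lintegral_mul_norm_pow_le (μ := volume.restrict (Metric.ball x r))
    (f := fun y => ‖F y‖ₑ ^ q) (g := fun _ => 1)
    (F.stronglyMeasurable.enorm.pow_const q).aemeasurable aemeasurable_const
    (p := 1 / q) (q := 1 - 1 / q) (by positivity) hq1 (by ring)
  simp only [ENNReal.one_rpow, mul_one, ← ENNReal.rpow_mul, mul_one_div_cancel hq0.ne',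
    ENNReal.rpow_one, lintegral_const, one_mul, Measure.restrict_apply_univ] at h
  refine h.trans ?_
  rw [mul_right_comm]
  gcongr
  exact lintegral_ball_le_morreyNorm hp hq hσ hr x F

section Pairing

variable {p₀ q₀ p₁ q₁ σ : ℝ} {X₀ X₁ : NormedSubspace (FunClass n)}

lemma lintegral_ball_le_sumNorm (hp₀ : 0 < p₀) (hq₀ : 1 ≤ q₀) (hσ₀ : q₀ / p₀ = σ)
    (hp₁ : 0 < p₁) (hq₁ : 1 ≤ q₁) (hσ₁ : q₁ / p₁ = σ)
    (hX₀ : X₀.nrm = morreyNorm p₀ q₀) (hX₁ : X₁.nrm = morreyNorm p₁ q₁)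
    {r : ℝ} (hr : 0 < r) (x : EuclideanSpace ℝ (Fin n)) :
    ∃ K : ℝ≥0, ∀ F : FunClass n,
      ∫⁻ y in Metric.ball x r, ‖F y‖ₑ ≤ K * X₀.sumNorm X₁ F := by
  obtain ⟨K₀, hK₀⟩ := lintegral_enorm_ball_le hp₀ hq₀ hσ₀ hr x
  obtain ⟨K₁, hK₁⟩ := lintegral_enorm_ball_le hp₁ hq₁ hσ₁ hr x
  -- the summand `1` keeps the constant nonzero, so that it can be divided out of the infimum
  refine ⟨K₀ + K₁ + 1, fun F => ?_⟩
  rw [mul_comm, ← ENNReal.div_le_iff_le_mul (Or.inl (by simp)) (Or.inl (by simp))]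
  refine le_iInf fun a => le_iInf fun _ => le_iInf fun b => le_iInf fun _ => le_iInf fun hab => ?_
  rw [ENNReal.div_le_iff_le_mul (Or.inl (by simp)) (Or.inl (by simp)), mul_comm, hX₀, hX₁]
  have h1 : ∫⁻ y in Metric.ball x r, ‖F y‖ₑ
      ≤ ∫⁻ y in Metric.ball x r, (‖a y‖ₑ + ‖b y‖ₑ) := by
    subst hab
    apply lintegral_mono_ae
    filter_upwards [ae_restrict_of_ae (AEEqFun.coeFn_add a b)] with y hy
    rw [hy]
    exact enorm_add_le _ _
  rw [lintegral_add_left a.stronglyMeasurable.enorm] at h1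
  refine h1.trans ((add_le_add (hK₀ a) (hK₁ b)).trans ?_)
  rw [mul_add]
  gcongr
  · exact le_add_right le_self_add
  · exact le_add_right le_add_self

lemma sumNorm_lt_top {Z : Type*} [AddCommGroup Z] [Module ℂ Z] {X₀ X₁ : NormedSubspace Z}
    {z : Z} (hz : z ∈ X₀.carrier ⊔ X₁.carrier) : X₀.sumNorm X₁ z < ∞ := by
  obtain ⟨a, ha, b, hb, hab⟩ := Submodule.mem_sup.1 hz
  exact (iInf₂_le_of_le a ha (iInf₂_le_of_le b hb (iInf_le _ hab))).trans_lt
    (ENNReal.add_lt_top.2 ⟨X₀.nrm_lt_top a ha, X₁.nrm_lt_top b hb⟩)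

lemma isSumFunctional_integral (hp₀ : 0 < p₀) (hq₀ : 1 ≤ q₀) (hσ₀ : q₀ / p₀ = σ)
    (hp₁ : 0 < p₁) (hq₁ : 1 ≤ q₁) (hσ₁ : q₁ / p₁ = σ)
    (hX₀ : X₀.nrm = morreyNorm p₀ q₀) (hX₁ : X₁.nrm = morreyNorm p₁ q₁)
    {r : ℝ} (hr : 0 < r) {x : EuclideanSpace ℝ (Fin n)} {A : Set (EuclideanSpace ℝ (Fin n))}
    (hA : A ⊆ Metric.ball x r)
    {ω : EuclideanSpace ℝ (Fin n) → ℂ} (hωm : Measurable ω) (hω : ∀ y, ‖ω y‖ ≤ 1) :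
    IsSumFunctional X₀ X₁ (fun F => ∫ y in A, ω y * F y) := by
  obtain ⟨K, hK⟩ := lintegral_ball_le_sumNorm hp₀ hq₀ hσ₀ hp₁ hq₁ hσ₁ hX₀ hX₁ hr x
  have hle : ∀ F : FunClass n, ∫⁻ y in A, ‖ω y * F y‖ₑ ≤ K * X₀.sumNorm X₁ F := fun F => by
    refine le_trans ?_ ((lintegral_mono_set hA).trans (hK F))
    refine lintegral_mono fun y => ?_
    rw [enorm_mul]
    have : ‖ω y‖ₑ ≤ 1 := by
      rw [← ofReal_norm]
      exact ENNReal.ofReal_le_one.2 (hω y)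
    exact (mul_le_mul_left this _).trans_eq (one_mul _)
  have hint : ∀ F ∈ X₀.carrier ⊔ X₁.carrier,
      Integrable (fun y => ω y * F y) (volume.restrict A) := fun F hF =>
    ⟨(hωm.stronglyMeasurable.mul F.stronglyMeasurable).aestronglyMeasurable,
      (hle F).trans_lt (ENNReal.mul_lt_top ENNReal.coe_lt_top (sumNorm_lt_top hF))⟩
  refine ⟨fun F hF H hH => ?_, fun c F hF => ?_, K, fun F _ => ?_⟩
  · rw [← integral_sub (hint F hF) (hint H hH)]
    apply integral_congr_ae
    filter_upwards [ae_restrict_of_ae (AEEqFun.coeFn_sub F H)] with y hy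
    rw [hy, Pi.sub_apply, mul_sub]
  · rw [← integral_const_mul]
    apply integral_congr_ae
    filter_upwards [ae_restrict_of_ae (AEEqFun.coeFn_smul c F)] with y hy
    rw [hy, Pi.smul_apply, smul_eq_mul]
    ring
  · exact (enorm_integral_le_lintegral_enorm _).trans (hle F)

end Pairing

/-! ### Pairing difference quotients with step functions -/

lemma lintegral_eq_sum_fiber {A : Set (EuclideanSpace ℝ (Fin n))} (hA : MeasurableSet A)
    {κ : EuclideanSpace ℝ (Fin n) → ℤ} (hκ : Measurable κ) {T : Finset ℤ} (hT : ∀ y ∈ A, κ y ∈ T)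
    (φ : EuclideanSpace ℝ (Fin n) → ℝ≥0∞) :
    ∫⁻ y in A, φ y = ∑ k ∈ T, ∫⁻ y in A ∩ κ ⁻¹' {k}, φ y := by
  have hmeas : ∀ k : ℤ, MeasurableSet (A ∩ κ ⁻¹' {k}) := fun k =>
    hA.inter (hκ (measurableSet_singleton k))
  have hU : (⋃ k ∈ T, A ∩ κ ⁻¹' {k}) = A := by
    ext y
    simp only [Set.mem_iUnion, Set.mem_inter_iff, Set.mem_preimage, Set.mem_singleton_iff]
    exact ⟨fun ⟨_, _, h, _⟩ => h, fun h => ⟨κ y, hT y h, h, rfl⟩⟩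
  rw [← lintegral_biUnion_finset _ (fun k _ => hmeas k), hU]
  intro i _ j _ hij
  refine Set.disjoint_left.2 fun y hi hj => hij ?_
  exact (hi.2 : κ y = i).symm.trans hj.2

lemma lintegral_exp_ne_top {q r : ℝ} (hq : 0 < q) {x : EuclideanSpace ℝ (Fin n)}
    {A : Set (EuclideanSpace ℝ (Fin n))} (hAm : MeasurableSet A) (hA : A ⊆ Metric.ball x r)
    {κ : EuclideanSpace ℝ (Fin n) → ℤ} {N : ℕ} (hN : ∀ y ∈ A, |κ y| ≤ N) :
    ∫⁻ y in A, ENNReal.ofReal (Real.exp (κ y * q)) ≠ ∞ := by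
  have h : ∫⁻ y in A, ENNReal.ofReal (Real.exp (κ y * q))
      ≤ ENNReal.ofReal (Real.exp (N * q)) * volume (Metric.ball x r) := by
    calc ∫⁻ y in A, ENNReal.ofReal (Real.exp (κ y * q))
        ≤ ∫⁻ _ in A, ENNReal.ofReal (Real.exp (N * q)) := by
          refine setLIntegral_mono' hAm fun y hy => ?_
          refine ENNReal.ofReal_le_ofReal (Real.exp_le_exp.2 ?_)
          have : (κ y : ℝ) ≤ N := by exact_mod_cast (le_abs_self _).trans (hN y hy)
          gcongr
      _ ≤ _ := by
          rw [setLIntegral_const]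
          gcongr
  exact (h.trans_lt (ENNReal.mul_lt_top ENNReal.ofReal_lt_top measure_ball_lt_top)).ne

/-- Hölder's inequality on `A` against the function `exp (κ q (1 - 1/q'))`, which is constant on the
level sets of `κ`. The exponent `q' = 1` is allowed. -/
lemma sum_lintegral_le {q q' : ℝ} (hq' : 1 ≤ q')
    {A : Set (EuclideanSpace ℝ (Fin n))} (hA : MeasurableSet A)
    {κ : EuclideanSpace ℝ (Fin n) → ℤ} (hκ : Measurable κ) {T : Finset ℤ} (hT : ∀ y ∈ A, κ y ∈ T)
    (D : FunClass n) :
    ∑ k ∈ T, ENNReal.ofReal (Real.exp (k * (q * (1 - 1 / q')))) *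
        ∫⁻ y in A ∩ κ ⁻¹' {k}, ‖D y‖ₑ
      ≤ (∫⁻ y in A, ‖D y‖ₑ ^ q') ^ (1 / q') *
        (∫⁻ y in A, ENNReal.ofReal (Real.exp (κ y * q))) ^ (1 - 1 / q') := by
  have hq0 : 0 < q' := by linarith
  have hq1 : 0 ≤ 1 - 1 / q' := by
    rw [sub_nonneg, div_le_one hq0]; exact hq'
  have hmeas : ∀ k : ℤ, MeasurableSet (A ∩ κ ⁻¹' {k}) := fun k =>
    hA.inter (hκ (measurableSet_singleton k))
  have hcast : Measurable fun y => (κ y : ℝ) :=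
    (measurable_of_countable (fun k : ℤ => (k : ℝ))).comp hκ
  have h1 : ∀ k ∈ T, ENNReal.ofReal (Real.exp (k * (q * (1 - 1 / q')))) *
        ∫⁻ y in A ∩ κ ⁻¹' {k}, ‖D y‖ₑ
      = ∫⁻ y in A ∩ κ ⁻¹' {k}, (‖D y‖ₑ ^ q') ^ (1 / q') *
        ENNReal.ofReal (Real.exp (κ y * q)) ^ (1 - 1 / q') := by
    intro k _
    rw [← lintegral_const_mul' _ _ ENNReal.ofReal_ne_top]
    refine setLIntegral_congr_fun (hmeas k) fun y hy => ?_
    have hk : κ y = k := hy.2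
    rw [hk, ← ENNReal.rpow_mul, mul_one_div_cancel hq0.ne', ENNReal.rpow_one,
      ENNReal.ofReal_rpow_of_nonneg (Real.exp_pos _).le hq1, ← Real.exp_mul, mul_comm, mul_assoc]
  rw [Finset.sum_congr rfl h1, ← lintegral_eq_sum_fiber hA hκ hT]
  exact ENNReal.lintegral_mul_norm_pow_le (D.stronglyMeasurable.enorm.pow_const _).aemeasurable
    (hcast.mul_const q).exp.ennreal_ofReal.aemeasurable (by positivity) hq1 (by ring)

/-- The affine function `q (1 - 1/q(z))` with `1/q(z) = (1-z)/q₀ + z/q₁`: raising a function to this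
power gives the analytic family dual to `L^{q₀}` and `L^{q₁}`. -/
def dualExponent (q q₀ q₁ : ℝ) (z : ℂ) : ℂ := q * (1 - ((1 - z) / q₀ + z / q₁))

lemma dualExponent_re (q q₀ q₁ : ℝ) (z : ℂ) :
    (dualExponent q q₀ q₁ z).re = q * (1 - ((1 - z.re) / q₀ + z.re / q₁)) := by
  simp [dualExponent, Complex.div_ofReal_re]

lemma norm_exp_dualExponent_le {q q₀ q₁ : ℝ} (hq : 0 < q) (hq₀ : 1 ≤ q₀) (hq₁ : 1 ≤ q₁)
    {N : ℕ} {k : ℤ} (hk : |k| ≤ N) {z : ℂ} (hz : z ∈ closedStrip) :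
    ‖Complex.exp (k * dualExponent q q₀ q₁ z)‖ ≤ Real.exp (N * q) := by
  rw [Complex.norm_exp, Real.exp_le_exp, ← Complex.ofReal_intCast, Complex.re_ofReal_mul,
    dualExponent_re]
  have h0 : 0 < q₀ := by linarith
  have h1 : 0 < q₁ := by linarith
  have a0 : 1 / q₀ ≤ 1 := by rw [div_le_one h0]; exact hq₀
  have a1 : 1 / q₁ ≤ 1 := by rw [div_le_one h1]; exact hq₁
  have hz0 : 0 ≤ z.re := hz.1
  have hz1 : 0 ≤ 1 - z.re := sub_nonneg.2 hz.2
  set e := (1 - z.re) / q₀ + z.re / q₁ with he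
  have e0 : 0 ≤ e := by positivity
  have e1 : e ≤ 1 := by
    have : e = (1 - z.re) * (1 / q₀) + z.re * (1 / q₁) := by rw [he]; ring
    rw [this]
    nlinarith
  have hkR : |(k : ℝ)| ≤ N := by exact_mod_cast hk
  calc (k : ℝ) * (q * (1 - e)) ≤ |(k : ℝ)| * (q * (1 - e)) :=
        mul_le_mul_of_nonneg_right (le_abs_self _) (mul_nonneg hq.le (by linarith))
    _ ≤ N * q := by
        apply mul_le_mul hkR _ (mul_nonneg hq.le (by linarith)) (by positivity)
        nlinarith

lemma nrm_difference_quotient_le {X : NormedSubspace (FunClass n)} {G : ℂ → FunClass n} {L : ℝ≥0}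
    {c : ℂ} (hmem : ∀ t : ℝ, G (c + t * Complex.I) ∈ X.carrier)
    (hL : ∀ s t : ℝ, X.nrm (G (c + s * Complex.I) - G (c + t * Complex.I)) ≤ L * ‖s - t‖ₑ)
    {h : ℝ} (hh : h ≠ 0) (t : ℝ) :
    X.nrm ((h * Complex.I)⁻¹ • (G (c + t * Complex.I + h * Complex.I) - G (c + t * Complex.I)))
      ≤ L := by
  have he : c + t * Complex.I + h * Complex.I = c + ((t + h : ℝ) : ℂ) * Complex.I := by
    push_cast; ring
  rw [he, X.nrm_smul _ _ (sub_mem (hmem _) (hmem _))]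
  refine (mul_le_mul_right (hL _ _) _).trans ?_
  have hh' : (h : ℂ) * Complex.I ≠ 0 := by simp [hh]
  have h2 : ‖(t + h - t : ℝ)‖ₑ = ‖(h : ℂ) * Complex.I‖ₑ := by
    rw [← ofReal_norm, ← ofReal_norm]
    simp
  rw [h2, mul_left_comm, enorm_inv hh', ENNReal.inv_mul_cancel (by simpa using hh) enorm_ne_top,
    mul_one]

section Pairing

variable {p₀ q₀ p₁ q₁ q σ θ : ℝ} {X₀ X₁ : NormedSubspace (FunClass n)}

/-- The pairing of the difference quotient `(G(z + ih) - G(z)) / (ih)` with the step function of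
value `exp (k e(z))` on the piece seen by the functional `l k`. -/
def sumQuotient (T : Finset ℤ) (e : ℂ → ℂ) (l : ℤ → FunClass n → ℂ) (G : ℂ → FunClass n)
    (h : ℝ) (z : ℂ) : ℂ :=
  ∑ k ∈ T, Complex.exp (k * e z) *
    ((h * Complex.I)⁻¹ * (l k (G (z + h * Complex.I)) - l k (G z)))

lemma norm_sumQuotient_boundary {p' q' : ℝ} (hp' : 0 < p') (hq' : 1 ≤ q') (hσ : q' / p' = σ)
    {X : NormedSubspace (FunClass n)}
    (hX : X.nrm = morreyNorm p' q') (hXs : X.carrier ≤ X₀.carrier ⊔ X₁.carrier)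
    {r : ℝ} (hr : 0 < r) {x : EuclideanSpace ℝ (Fin n)} {A : Set (EuclideanSpace ℝ (Fin n))}
    (hAm : MeasurableSet A) (hA : A ⊆ Metric.ball x r)
    {κ : EuclideanSpace ℝ (Fin n) → ℤ} (hκ : Measurable κ) {T : Finset ℤ} (hT : ∀ y ∈ A, κ y ∈ T)
    {ω : EuclideanSpace ℝ (Fin n) → ℂ} (hω : ∀ y, ‖ω y‖ ≤ 1)
    (hl : ∀ k, IsSumFunctional X₀ X₁ (fun F => ∫ y in A ∩ κ ⁻¹' {k}, ω y * F y))
    {G : ℂ → FunClass n} {L : ℝ≥0} {c : ℂ} (hmem : ∀ t : ℝ, G (c + t * Complex.I) ∈ X.carrier)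
    (hL : ∀ s t : ℝ, X.nrm (G (c + s * Complex.I) - G (c + t * Complex.I)) ≤ L * ‖s - t‖ₑ)
    {h : ℝ} (hh : h ≠ 0) (t : ℝ) {e : ℂ → ℂ}
    (he : (e (c + t * Complex.I)).re = q * (1 - 1 / q')) :
    ‖sumQuotient T e (fun k F => ∫ y in A ∩ κ ⁻¹' {k}, ω y * F y) G h (c + t * Complex.I)‖ₑ
      ≤ volume (Metric.ball x r) ^ ((1 - σ) / q') * L *
        (∫⁻ y in A, ENNReal.ofReal (Real.exp (κ y * q))) ^ (1 - 1 / q') := by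
  set D : FunClass n := (h * Complex.I)⁻¹ •
    (G (c + t * Complex.I + h * Complex.I) - G (c + t * Complex.I)) with hD
  have hm1 : G (c + t * Complex.I + h * Complex.I) ∈ X.carrier := by
    have he : c + t * Complex.I + h * Complex.I = c + ((t + h : ℝ) : ℂ) * Complex.I := by
      push_cast; ring
    rw [he]
    exact hmem _
  have hDL : morreyNorm p' q' D ≤ L := hX ▸ nrm_difference_quotient_le hmem hL hh t
  have hstep : ‖sumQuotient T e (fun k F => ∫ y in A ∩ κ ⁻¹' {k}, ω y * F y) G h
      (c + t * Complex.I)‖ₑ ≤ ∑ k ∈ T, ENNReal.ofReal (Real.exp (k * (q * (1 - 1 / q')))) *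
        ∫⁻ y in A ∩ κ ⁻¹' {k}, ‖D y‖ₑ := by
    unfold sumQuotient
    refine (enorm_sum_le _ _).trans (Finset.sum_le_sum fun k _ => ?_)
    rw [enorm_mul]
    have h1 : ‖Complex.exp (k * e (c + t * Complex.I))‖ₑ
        = ENNReal.ofReal (Real.exp (k * (q * (1 - 1 / q')))) := by
      rw [← ofReal_norm, Complex.norm_exp, ← Complex.ofReal_intCast, Complex.re_ofReal_mul, he]
    have h2 := (hl k).map_smul (h * Complex.I)⁻¹ _ (sub_mem (hXs hm1) (hXs (hmem t)))
    rw [(hl k).map_sub _ (hXs hm1) _ (hXs (hmem t))] at h2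
    rw [h1, ← h2]
    gcongr
    refine (enorm_integral_le_lintegral_enorm _).trans (lintegral_mono fun y => ?_)
    rw [enorm_mul]
    have : ‖ω y‖ₑ ≤ 1 := by
      rw [← ofReal_norm]
      exact ENNReal.ofReal_le_one.2 (hω y)
    exact (mul_le_mul_left this _).trans_eq (one_mul _)
  refine hstep.trans ((sum_lintegral_le hq' hAm hκ hT D).trans ?_)
  gcongr
  refine (ENNReal.rpow_le_rpow (lintegral_mono_set hA) (by positivity)).trans ?_
  exact (lintegral_ball_le_morreyNorm hp' hq' hσ hr x D).trans (by gcongr)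

/-- The derivative `f = G'(θ)`, paired with the step function `ω exp (κ (q - 1))` on `A`, is bounded
by the `L^{q'}` norm of `exp (κ (q - 1))`, with the constant that the Lipschitz bounds on the two
boundary lines dictate. The difference quotients of `G` in the imaginary direction are bounded in
`X₀` and `X₁` on these lines, so the three lines theorem applies to them, and they converge to `f`.
-/
lemma enorm_pairing_le (hp₀ : 0 < p₀) (hq₀ : 1 ≤ q₀) (hσ₀ : q₀ / p₀ = σ)
    (hp₁ : 0 < p₁) (hq₁ : 1 ≤ q₁) (hσ₁ : q₁ / p₁ = σ) (hq0 : 0 < q)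
    (hθ₀ : 0 < θ) (hθ₁ : θ < 1) (hq : 1 / q = (1 - θ) / q₀ + θ / q₁)
    (hX₀ : X₀.nrm = morreyNorm p₀ q₀) (hX₁ : X₁.nrm = morreyNorm p₁ q₁)
    {G : ℂ → FunClass n} (hG : MemG X₀ X₁ G) {f : FunClass n} (hf : HasSumDerivAt X₀ X₁ G f θ)
    {L₀ L₁ : ℝ≥0}
    (hL₀ : ∀ s t : ℝ, X₀.nrm (G (s * Complex.I) - G (t * Complex.I)) ≤ L₀ * ‖s - t‖ₑ)
    (hL₁ : ∀ s t : ℝ, X₁.nrm (G (1 + s * Complex.I) - G (1 + t * Complex.I)) ≤ L₁ * ‖s - t‖ₑ)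
    {r : ℝ} (hr : 0 < r) {x : EuclideanSpace ℝ (Fin n)} {A : Set (EuclideanSpace ℝ (Fin n))}
    (hAm : MeasurableSet A) (hA : A ⊆ Metric.ball x r)
    {κ : EuclideanSpace ℝ (Fin n) → ℤ} (hκ : Measurable κ) {N : ℕ} (hN : ∀ y ∈ A, |κ y| ≤ N)
    {ω : EuclideanSpace ℝ (Fin n) → ℂ} (hωm : Measurable ω) (hω : ∀ y, ‖ω y‖ ≤ 1) :
    ‖∑ k ∈ Finset.Icc (-(N : ℤ)) N, (Real.exp (k * (q - 1)) : ℂ) *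
        ∫ y in A ∩ κ ⁻¹' {k}, ω y * f y‖ₑ
      ≤ (L₀ : ℝ≥0∞) ^ (1 - θ) * L₁ ^ θ * volume (Metric.ball x r) ^ ((1 - σ) / q) *
        (∫⁻ y in A, ENNReal.ofReal (Real.exp (κ y * q))) ^ (1 - 1 / q) := by
  set T := Finset.Icc (-(N : ℤ)) N with hTdef
  have hT : ∀ y ∈ A, κ y ∈ T := fun y hy => Finset.mem_Icc.2 (abs_le.1 (hN y hy))
  have hTN : ∀ k ∈ T, |k| ≤ N := fun k hk => abs_le.2 (Finset.mem_Icc.1 hk)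
  set V := volume (Metric.ball x r) with hV
  have hV0 : V ≠ 0 := (Metric.measure_ball_pos _ _ hr).ne'
  have hV1 : V ≠ ∞ := measure_ball_lt_top.ne
  set J := ∫⁻ y in A, ENNReal.ofReal (Real.exp (κ y * q)) with hJ
  have hJfin : J ≠ ∞ := lintegral_exp_ne_top hq0 hAm hA hN
  set l : ℤ → FunClass n → ℂ := fun k F => ∫ y in A ∩ κ ⁻¹' {k}, ω y * F y with hldef
  have hl : ∀ k, IsSumFunctional X₀ X₁ (l k) := fun k =>
    isSumFunctional_integral hp₀ hq₀ hσ₀ hp₁ hq₁ hσ₁ hX₀ hX₁ hr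
      (Set.inter_subset_left.trans hA) hωm hω
  set e := dualExponent q q₀ q₁ with he
  have hγc : ∀ k, ContinuousOn (fun z => l k (G z)) closedStrip := fun k => (hl k).continuousOn hG
  have hγd : ∀ k, DifferentiableOn ℂ (fun z => l k (G z)) openStrip := fun k z hz => by
    obtain ⟨g, hg⟩ := hG.holomorphicOn z hz
    exact ((hl k).hasDerivAt hG hz hg).differentiableAt.differentiableWithinAt
  choose C hC0 hC using fun k => (hl k).growth hG
  have hshift : ∀ h : ℝ, Set.MapsTo (fun z : ℂ => z + h * Complex.I) closedStrip closedStrip :=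
    fun h z hz => by simpa [closedStrip] using hz
  have hshift' : ∀ h : ℝ, Set.MapsTo (fun z : ℂ => z + h * Complex.I) openStrip openStrip :=
    fun h z hz => by simpa [openStrip] using hz
  have hed : Differentiable ℂ e := by
    rw [he]; unfold dualExponent; fun_prop
  set B₀ := V ^ ((1 - σ) / q₀) * L₀ * J ^ (1 - 1 / q₀) with hB₀
  set B₁ := V ^ ((1 - σ) / q₁) * L₁ * J ^ (1 - 1 / q₁) with hB₁
  have hsub : ∀ {q' : ℝ}, 1 ≤ q' → 0 ≤ 1 - 1 / q' := fun {q'} h => by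
    rw [sub_nonneg, div_le_one (by linarith)]; exact h
  have hB₀f : B₀ ≠ ∞ := ENNReal.mul_ne_top (ENNReal.mul_ne_top
    (ENNReal.rpow_ne_top_of_ne_zero hV0 hV1) ENNReal.coe_ne_top)
    (ENNReal.rpow_ne_top_of_nonneg (hsub hq₀) hJfin)
  have hB₁f : B₁ ≠ ∞ := ENNReal.mul_ne_top (ENNReal.mul_ne_top
    (ENNReal.rpow_ne_top_of_ne_zero hV0 hV1) ENNReal.coe_ne_top)
    (ENNReal.rpow_ne_top_of_nonneg (hsub hq₁) hJfin)
  have key : ∀ h : ℝ, 0 < h → ‖sumQuotient T e l G h θ‖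
      ≤ B₀.toReal ^ (1 - θ) * B₁.toReal ^ θ := by
    intro h hh
    refine norm_le_of_growth_strip (g := sumQuotient T e l G h)
      (C := ∑ k ∈ T, Real.exp (N * q) * (h⁻¹ * (2 * C k * (1 + h)))) ?_ ?_ ?_ ?_ ?_ hθ₀ hθ₁
    · refine continuousOn_finsetSum _ fun k _ => ContinuousOn.mul ?_ ?_
      · exact (continuous_const.mul hed.continuous).cexp.continuousOn
      · refine continuousOn_const.mul (ContinuousOn.sub ?_ (hγc k))
        exact (hγc k).comp (by fun_prop) (hshift h)
    · refine DifferentiableOn.fun_sum fun k _ => DifferentiableOn.mul ?_ ?_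
      · exact (hed.const_mul _).cexp.differentiableOn
      · refine (DifferentiableOn.sub ?_ (hγd k)).const_mul _
        exact (hγd k).comp (by fun_prop) (hshift' h)
    · intro z hz
      rw [Finset.sum_mul]
      refine (norm_sum_le _ _).trans (Finset.sum_le_sum fun k hk => ?_)
      rw [norm_mul, norm_mul, mul_assoc, mul_assoc]
      have h1 := norm_exp_dualExponent_le hq0 hq₀ hq₁ (hTN k hk) hz
      have h2 : ‖(h * Complex.I)⁻¹‖ = h⁻¹ := by
        simp [abs_of_pos hh]
      rw [h2]
      have h3 := hC k _ (hshift h hz)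
      have h4 := hC k z hz
      have h5 : ‖z + h * Complex.I‖ ≤ ‖z‖ + h := by
        refine (norm_add_le _ _).trans ?_
        simp [abs_of_pos hh]
      have h6 : ‖l k (G (z + h * Complex.I)) - l k (G z)‖ ≤ 2 * C k * (1 + h) * (1 + ‖z‖) := by
        refine (norm_sub_le _ _).trans ((add_le_add h3 h4).trans ?_)
        have := mul_le_mul_of_nonneg_left h5 (hC0 k)
        have h7 : 0 ≤ C k * (h * ‖z‖) := mul_nonneg (hC0 k) (by positivity)
        have h8 : 0 ≤ C k * h := mul_nonneg (hC0 k) hh.le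
        linarith
      gcongr
    · intro z hz
      have hz' : z = 0 + z.im * Complex.I := by
        apply Complex.ext <;> simp [hz]
      have hb := norm_sumQuotient_boundary (q := q) hp₀ hq₀ hσ₀ hX₀ (le_sup_left (b := X₁.carrier))
        hr hAm hA hκ hT hω hl (G := G) (c := 0) (L := L₀) (by simpa using hG.lip_zero.1)
        (by simpa using hL₀) hh.ne' z.im (e := e) (by rw [← hz', he, dualExponent_re, hz]; simp)
      rw [← hz'] at hb
      rw [← toReal_enorm]
      exact ENNReal.toReal_mono hB₀f hb
    · intro z hz
      have hz' : z = 1 + z.im * Complex.I := by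
        apply Complex.ext <;> simp [hz]
      have hb := norm_sumQuotient_boundary (q := q) hp₁ hq₁ hσ₁ hX₁ (le_sup_right (a := X₀.carrier))
        hr hAm hA hκ hT hω hl (G := G) (c := 1) (L := L₁) hG.lip_one.1
        hL₁ hh.ne' z.im (e := e) (by rw [← hz', he, dualExponent_re, hz]; simp)
      rw [← hz'] at hb
      rw [← toReal_enorm]
      exact ENNReal.toReal_mono hB₁f hb
  have hθs : (θ : ℂ) ∈ openStrip := by simpa [openStrip] using ⟨hθ₀, hθ₁⟩
  have heθ : e θ = ((q - 1 : ℝ) : ℂ) := by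
    have : (1 - θ) / q₀ + θ / q₁ = 1 / q := hq.symm
    have h2 : q * (1 - ((1 - θ) / q₀ + θ / q₁)) = q - 1 := by
      rw [this]; field_simp
    rw [he, dualExponent, ← h2]
    push_cast
    ring
  -- as `h` tends to `0`, the difference quotients converge to `l k f`
  have hlim : Tendsto (fun h : ℝ => sumQuotient T e l G h θ) (𝓝[>] 0)
      (𝓝 (∑ k ∈ T, (Real.exp (k * (q - 1)) : ℂ) * l k f)) := by
    refine tendsto_finsetSum _ fun k _ => ?_
    have hexp : Complex.exp (k * e θ) = (Real.exp (k * (q - 1)) : ℂ) := by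
      rw [heθ]; push_cast; rfl
    rw [hexp]
    refine Tendsto.const_mul _ ?_
    have hd := (hl k).hasDerivAt hG hθs hf
    rw [hasDerivAt_iff_tendsto_slope_zero] at hd
    have ht : Tendsto (fun h : ℝ => (h : ℂ) * Complex.I) (𝓝[>] 0) (𝓝[≠] 0) := by
      refine tendsto_nhdsWithin_iff.2 ⟨?_, ?_⟩
      · have : Tendsto (fun h : ℝ => (h : ℂ) * Complex.I) (𝓝 0) (𝓝 (((0 : ℝ) : ℂ) * Complex.I)) :=
          (by fun_prop : Continuous fun h : ℝ => (h : ℂ) * Complex.I).tendsto 0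
        simp only [Complex.ofReal_zero, zero_mul] at this
        exact this.mono_left nhdsWithin_le_nhds
      · filter_upwards [self_mem_nhdsWithin] with h hh
        simpa using (ne_of_gt hh : h ≠ 0)
    exact hd.comp ht
  have hfinal := le_of_tendsto hlim.norm (by
    filter_upwards [self_mem_nhdsWithin] with h hh using key h hh)
  rw [← ofReal_norm]
  refine (ENNReal.ofReal_le_ofReal hfinal).trans_eq ?_
  rw [ENNReal.ofReal_mul (by positivity),
    ← ENNReal.ofReal_rpow_of_nonneg ENNReal.toReal_nonneg (by linarith),
    ← ENNReal.ofReal_rpow_of_nonneg ENNReal.toReal_nonneg hθ₀.le,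
    ENNReal.ofReal_toReal hB₀f, ENNReal.ofReal_toReal hB₁f, hB₀, hB₁]
  have hθ1 : 0 ≤ 1 - θ := by linarith
  simp only [ENNReal.mul_rpow_of_nonneg _ _ hθ1, ENNReal.mul_rpow_of_nonneg _ _ hθ₀.le,
    ← ENNReal.rpow_mul]
  -- the powers of the volume and of `J` in `B₀ ^ (1 - θ) * B₁ ^ θ` combine by the relation for `q`
  have e1 : (1 - σ) / q = (1 - σ) / q₀ * (1 - θ) + (1 - σ) / q₁ * θ := by
    have : (1 - σ) / q = (1 - σ) * (1 / q) := by ring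
    rw [this, hq]; ring
  have e2 : 1 - 1 / q = (1 - 1 / q₀) * (1 - θ) + (1 - 1 / q₁) * θ := by
    rw [hq]; ring
  rw [e1, e2, ENNReal.rpow_add _ _ hV0 hV1,
    ENNReal.rpow_add_of_nonneg _ _ (mul_nonneg (hsub hq₀) hθ1) (mul_nonneg (hsub hq₁) hθ₀.le)]
  ring

end Pairing

/-! ### Derivatives of functions in the class `𝒢` -/

section Subset

variable {p₀ q₀ p₁ q₁ q σ θ : ℝ} {X₀ X₁ : NormedSubspace (FunClass n)}

lemma ENNReal.le_rpow_of_le_mul_rpow {J M : ℝ≥0∞} (hJ : J ≠ ∞) {q : ℝ} (hq : 0 < q)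
    (h : J ≤ M * J ^ (1 - 1 / q)) : J ≤ M ^ q := by
  rcases eq_or_ne J 0 with rfl | hJ0
  · exact zero_le
  have h1 : J ^ (1 / q) ≤ M := by
    have e : J ^ (1 / q) * J ^ (1 - 1 / q) = J := by
      rw [← ENNReal.rpow_add _ _ hJ0 hJ]
      simp
    rw [← e] at h
    have h2 : J ^ (1 - 1 / q) ≠ 0 := by simp [ENNReal.rpow_eq_zero_iff, hJ0, hJ]
    have h3 : J ^ (1 - 1 / q) ≠ ∞ := ENNReal.rpow_ne_top_of_ne_zero hJ0 hJ
    rw [e] at h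
    exact (ENNReal.mul_le_mul_iff_left h2 h3).1 (e.le.trans h)
  calc J = (J ^ (1 / q)) ^ q := by
        rw [← ENNReal.rpow_mul, one_div_mul_cancel hq.ne', ENNReal.rpow_one]
    _ ≤ M ^ q := ENNReal.rpow_le_rpow h1 hq.le

/-- Duality: `enorm_pairing_le` is applied with `κ = ⌊log |f|⌋` and `ω = conj (sgn f)`. Then
`exp κ ≤ |f| ≤ e · exp κ`, and `J = ∫ exp (κ q)` satisfies `J ≤ M J^{1 - 1/q}`. The restriction to
`|κ| ≤ N` makes `J` finite. -/
lemma lintegral_rpow_shell_le (hp₀ : 0 < p₀) (hq₀ : 1 ≤ q₀) (hσ₀ : q₀ / p₀ = σ)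
    (hp₁ : 0 < p₁) (hq₁ : 1 ≤ q₁) (hσ₁ : q₁ / p₁ = σ) (hq0 : 0 < q)
    (hθ₀ : 0 < θ) (hθ₁ : θ < 1) (hq : 1 / q = (1 - θ) / q₀ + θ / q₁)
    (hX₀ : X₀.nrm = morreyNorm p₀ q₀) (hX₁ : X₁.nrm = morreyNorm p₁ q₁)
    {G : ℂ → FunClass n} (hG : MemG X₀ X₁ G) {f : FunClass n} (hf : HasSumDerivAt X₀ X₁ G f θ)
    {L₀ L₁ : ℝ≥0}
    (hL₀ : ∀ s t : ℝ, X₀.nrm (G (s * Complex.I) - G (t * Complex.I)) ≤ L₀ * ‖s - t‖ₑ)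
    (hL₁ : ∀ s t : ℝ, X₁.nrm (G (1 + s * Complex.I) - G (1 + t * Complex.I)) ≤ L₁ * ‖s - t‖ₑ)
    {r : ℝ} (hr : 0 < r) (x : EuclideanSpace ℝ (Fin n)) (N : ℕ) :
    ∫⁻ y in Metric.ball x r ∩ {y | f y ≠ 0 ∧ |⌊Real.log ‖f y‖⌋| ≤ N}, ‖f y‖ₑ ^ q
      ≤ ENNReal.ofReal (Real.exp q) *
        ((L₀ : ℝ≥0∞) ^ (1 - θ) * L₁ ^ θ * volume (Metric.ball x r) ^ ((1 - σ) / q)) ^ q := by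
  have hfm : Measurable f := f.stronglyMeasurable.measurable
  set κ : EuclideanSpace ℝ (Fin n) → ℤ := fun y => ⌊Real.log ‖f y‖⌋
  have hκ : Measurable κ := (Real.measurable_log.comp hfm.norm).floor
  set A := Metric.ball x r ∩ {y | f y ≠ 0 ∧ |κ y| ≤ N} with hAdef
  have hAm : MeasurableSet A := by
    refine measurableSet_ball.inter (MeasurableSet.inter ?_ ?_)
    · exact (measurableSet_singleton (0 : ℂ)).compl.preimage hfm
    · exact (Set.to_countable {k : ℤ | |k| ≤ N}).measurableSet.preimage hκ
  have hA : A ⊆ Metric.ball x r := Set.inter_subset_left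
  set ω : EuclideanSpace ℝ (Fin n) → ℂ := fun y => (starRingEnd ℂ) (f y) / ‖f y‖ with hωdef
  have hωm : Measurable ω :=
    (Complex.continuous_conj.measurable.comp hfm).div (Complex.measurable_ofReal.comp hfm.norm)
  have hω : ∀ y, ‖ω y‖ ≤ 1 := fun y => by
    simp only [hωdef, norm_div, RCLike.norm_conj, Complex.norm_real, norm_norm]
    exact div_self_le_one _
  have hωf : ∀ y, ω y * f y = (‖f y‖ : ℂ) := fun y => by
    simp only [hωdef]
    rcases eq_or_ne (f y) 0 with h0 | h0
    · simp [h0]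
    · have : (‖f y‖ : ℂ) ≠ 0 := by simpa using h0
      rw [div_mul_eq_mul_div, mul_comm, Complex.mul_conj, Complex.normSq_eq_norm_sq]
      field_simp
      push_cast
      ring
  have hlo : ∀ y ∈ A, Real.exp (κ y) ≤ ‖f y‖ := fun y hy => by
    rw [← Real.le_log_iff_exp_le (norm_pos_iff.2 hy.2.1)]
    exact Int.floor_le _
  have hhi : ∀ y ∈ A, ‖f y‖ ≤ Real.exp (κ y + 1) := fun y hy => by
    rw [← Real.log_le_iff_le_exp (norm_pos_iff.2 hy.2.1)]
    exact (Int.lt_floor_add_one _).le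
  set J := ∫⁻ y in A, ENNReal.ofReal (Real.exp (κ y * q)) with hJ
  have hJfin : J ≠ ∞ := lintegral_exp_ne_top hq0 hAm hA (fun y hy => hy.2.2)
  have hpair := enorm_pairing_le hp₀ hq₀ hσ₀ hp₁ hq₁ hσ₁ hq0 hθ₀ hθ₁ hq hX₀ hX₁ hG hf hL₀ hL₁
    hr hAm hA hκ (N := N) (fun y hy => hy.2.2) hωm hω
  have hmeas : ∀ k : ℤ, MeasurableSet (A ∩ κ ⁻¹' {k}) := fun k =>
    hAm.inter (hκ (measurableSet_singleton k))
  have hJle : J ≤ ‖∑ k ∈ Finset.Icc (-(N : ℤ)) N, (Real.exp (k * (q - 1)) : ℂ) *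
        ∫ y in A ∩ κ ⁻¹' {k}, ω y * f y‖ₑ := by
    have hreal : ∑ k ∈ Finset.Icc (-(N : ℤ)) N, (Real.exp (k * (q - 1)) : ℂ) *
          ∫ y in A ∩ κ ⁻¹' {k}, ω y * f y
        = ((∑ k ∈ Finset.Icc (-(N : ℤ)) N, Real.exp (k * (q - 1)) *
          ∫ y in A ∩ κ ⁻¹' {k}, ‖f y‖ : ℝ) : ℂ) := by
      simp_rw [hωf]
      push_cast
      refine Finset.sum_congr rfl fun k _ => ?_
      rw [integral_complex_ofReal]
    have hnn : ∀ k ∈ Finset.Icc (-(N : ℤ)) N, 0 ≤ Real.exp (k * (q - 1)) *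
        ∫ y in A ∩ κ ⁻¹' {k}, ‖f y‖ := fun k _ =>
      mul_nonneg (Real.exp_pos _).le (integral_nonneg fun _ => norm_nonneg _)
    rw [hreal, ← ofReal_norm, Complex.norm_real, Real.norm_of_nonneg (Finset.sum_nonneg hnn),
      ENNReal.ofReal_sum_of_nonneg hnn, hJ,
      lintegral_eq_sum_fiber hAm hκ (fun y hy => Finset.mem_Icc.2 (abs_le.1 hy.2.2))]
    refine Finset.sum_le_sum fun k _ => ?_
    have hint : Integrable (fun y => ‖f y‖) (volume.restrict (A ∩ κ ⁻¹' {k})) := by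
      refine Measure.integrableOn_of_bounded (M := Real.exp (k + 1)) ?_
        hfm.norm.aestronglyMeasurable ?_
      · exact ((measure_mono (Set.inter_subset_left.trans hA)).trans_lt measure_ball_lt_top).ne
      · refine (ae_restrict_iff' (hmeas k)).2 (ae_of_all _ fun y hy => ?_)
        have hk : κ y = k := hy.2
        rw [norm_norm, ← hk]
        exact hhi y hy.1
    rw [ENNReal.ofReal_mul (Real.exp_pos _).le,
      ofReal_integral_eq_lintegral_ofReal hint (ae_of_all _ fun _ => norm_nonneg _),
      ← lintegral_const_mul' _ _ ENNReal.ofReal_ne_top]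
    refine setLIntegral_mono' (hmeas k) fun y hy => ?_
    have hk : κ y = k := hy.2
    rw [← ENNReal.ofReal_mul (Real.exp_pos _).le]
    refine ENNReal.ofReal_le_ofReal ?_
    have h1 := hlo y hy.1
    rw [hk] at h1 ⊢
    calc Real.exp (k * q) = Real.exp (k * (q - 1)) * Real.exp k := by
          rw [← Real.exp_add]; ring_nf
      _ ≤ _ := by gcongr
  have hJ2 := ENNReal.le_rpow_of_le_mul_rpow hJfin hq0 (hJle.trans hpair)
  refine le_trans ?_ (mul_le_mul_right hJ2 _)
  rw [hJ, ← lintegral_const_mul' _ _ ENNReal.ofReal_ne_top]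
  refine setLIntegral_mono' hAm fun y hy => ?_
  rw [← ofReal_norm, ENNReal.ofReal_rpow_of_nonneg (norm_nonneg _) hq0.le,
    ← ENNReal.ofReal_mul (Real.exp_pos _).le]
  refine ENNReal.ofReal_le_ofReal ?_
  calc ‖f y‖ ^ q ≤ Real.exp (κ y + 1) ^ q :=
        Real.rpow_le_rpow (norm_nonneg _) (hhi y hy) hq0.le
    _ = _ := by rw [← Real.exp_mul, ← Real.exp_add]; ring_nf

/-- The second interpolation space of two subspaces of Morrey spaces with the same ratio `q/p = σ`
consists of Morrey functions. -/
theorem morreyMass_lt_top_of_hasSumDerivAt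
    (hp₀ : 0 < p₀) (hq₀ : 1 ≤ q₀) (hσ₀ : q₀ / p₀ = σ)
    (hp₁ : 0 < p₁) (hq₁ : 1 ≤ q₁) (hσ₁ : q₁ / p₁ = σ) (hq0 : 0 < q)
    (hθ₀ : 0 < θ) (hθ₁ : θ < 1) (hq : 1 / q = (1 - θ) / q₀ + θ / q₁)
    (hX₀ : X₀.nrm = morreyNorm p₀ q₀) (hX₁ : X₁.nrm = morreyNorm p₁ q₁)
    {G : ℂ → FunClass n} (hG : MemG X₀ X₁ G) {f : FunClass n} (hf : HasSumDerivAt X₀ X₁ G f θ) :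
    morreyMass σ (fun y => ‖f y‖ₑ ^ q) < ∞ := by
  obtain ⟨L₀, hL₀⟩ := hG.lip_zero.2
  obtain ⟨L₁, hL₁⟩ := hG.lip_one.2
  have hθ1 : 0 ≤ 1 - θ := by linarith
  set M : ℝ≥0∞ := (L₀ : ℝ≥0∞) ^ (1 - θ) * L₁ ^ θ with hM
  have hMfin : M ≠ ∞ := ENNReal.mul_ne_top (ENNReal.rpow_ne_top_of_nonneg hθ1 ENNReal.coe_ne_top)
    (ENNReal.rpow_ne_top_of_nonneg hθ₀.le ENNReal.coe_ne_top)
  have hbound : morreyMass σ (fun y => ‖f y‖ₑ ^ q) ≤ ENNReal.ofReal (Real.exp q) * M ^ q := by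
    refine iSup₂_le fun r hr => iSup_le fun x => ?_
    have h0 : volume (Metric.ball x r) ≠ 0 := (Metric.measure_ball_pos _ _ hr).ne'
    have h1 : volume (Metric.ball x r) ≠ ∞ := measure_ball_lt_top.ne
    have hfm : Measurable f := f.stronglyMeasurable.measurable
    set κ : EuclideanSpace ℝ (Fin n) → ℤ := fun y => ⌊Real.log ‖f y‖⌋
    have hκ : Measurable κ := (Real.measurable_log.comp hfm.norm).floor
    set A : ℕ → Set (EuclideanSpace ℝ (Fin n)) := fun N => {y | f y ≠ 0 ∧ |κ y| ≤ N} with hA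
    have hAm : ∀ N, MeasurableSet (A N) := fun N =>
      ((measurableSet_singleton (0 : ℂ)).compl.preimage hfm).inter
        ((Set.to_countable {k : ℤ | |k| ≤ N}).measurableSet.preimage hκ)
    have hmono : Monotone fun N : ℕ => (A N).indicator (fun y => ‖f y‖ₑ ^ q) := fun N N' h =>
      Set.indicator_le_indicator_of_subset
        (fun y hy => ⟨hy.1, hy.2.trans (by exact_mod_cast h)⟩) (fun _ => zero_le)
    have hsup : ∀ y, ‖f y‖ₑ ^ q = ⨆ N : ℕ, (A N).indicator (fun y => ‖f y‖ₑ ^ q) y := by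
      intro y
      refine le_antisymm ?_ (iSup_le fun N => Set.indicator_le_self _ _ _)
      rcases eq_or_ne (f y) 0 with hy | hy
      · simp [hy, hq0]
      · refine le_iSup_of_le (κ y).natAbs ?_
        rw [Set.indicator_of_mem]
        exact ⟨hy, by simp⟩
    have hint : ∫⁻ y in Metric.ball x r, ‖f y‖ₑ ^ q
        ≤ ENNReal.ofReal (Real.exp q) * (M * volume (Metric.ball x r) ^ ((1 - σ) / q)) ^ q := by
      calc ∫⁻ y in Metric.ball x r, ‖f y‖ₑ ^ q
          = ⨆ N : ℕ, ∫⁻ y in Metric.ball x r, (A N).indicator (fun y => ‖f y‖ₑ ^ q) y := by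
            rw [← lintegral_iSup (fun N =>
              (f.stronglyMeasurable.enorm.pow_const q).indicator (hAm N)) hmono]
            exact lintegral_congr hsup
        _ ≤ _ := by
            refine iSup_le fun N => ?_
            rw [setLIntegral_indicator (hAm N), Set.inter_comm]
            exact lintegral_rpow_shell_le hp₀ hq₀ hσ₀ hp₁ hq₁ hσ₁ hq0 hθ₀ hθ₁ hq hX₀ hX₁ hG hf
              hL₀ hL₁ hr x N
    refine (mul_le_mul_right hint _).trans_eq ?_
    have hV : volume (Metric.ball x r) ^ (σ - 1) * volume (Metric.ball x r) ^ (1 - σ) = 1 := by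
      rw [← ENNReal.rpow_add _ _ h0 h1]
      simp
    rw [ENNReal.mul_rpow_of_nonneg _ _ hq0.le, ← ENNReal.rpow_mul, div_mul_cancel₀ _ hq0.ne']
    calc _ = volume (Metric.ball x r) ^ (σ - 1) * volume (Metric.ball x r) ^ (1 - σ) *
          (ENNReal.ofReal (Real.exp q) * M ^ q) := by ring
      _ = _ := by rw [hV, one_mul]
  refine hbound.trans_lt (ENNReal.mul_lt_top ENNReal.ofReal_lt_top ?_)
  exact (ENNReal.rpow_ne_top_of_nonneg hq0.le hMfin).lt_top

lemma coeFn_truncation (a b : ℝ) (f : FunClass n) :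
    ⇑(truncation a b f) =ᵐ[volume] {y | a ≤ ‖f y‖ ∧ ‖f y‖ ≤ b}.indicator f :=
  AEEqFun.coeFn_mk _ _

/-- Where `|f₀ + f₁| ≥ a`, one of `|f₀|`, `|f₁|` is at least `a/2`; so a truncation of `f₀ + f₁` is
controlled by `|f₀|^{q₀} + |f₁|^{q₁}` for any exponents. -/
lemma enorm_truncation_add_le (hq₀ : 0 < q₀) (hq₁ : 0 < q₁) (hq : 0 < q) {a b : ℝ} (ha : 0 < a)
    (hb : 0 < b) {f₀ f₁ : FunClass n} :
    ∀ᵐ y, ‖truncation a b (f₀ + f₁) y‖ₑ ^ q ≤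
      ENNReal.ofReal (b ^ q * (2 / a) ^ q₀) * ‖f₀ y‖ₑ ^ q₀ +
        ENNReal.ofReal (b ^ q * (2 / a) ^ q₁) * ‖f₁ y‖ₑ ^ q₁ := by
  filter_upwards [coeFn_truncation a b (f₀ + f₁), AEEqFun.coeFn_add f₀ f₁] with y hy hadd
  rw [hy]
  by_cases hmem : y ∈ {y | a ≤ ‖(f₀ + f₁) y‖ ∧ ‖(f₀ + f₁) y‖ ≤ b}
  · rw [Set.indicator_of_mem hmem]
    have h1 : ∀ {s t : ℝ}, 0 < s → a / 2 ≤ t → b ^ q ≤ b ^ q * (2 / a) ^ s * t ^ s := by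
      intro s t hs ht
      have : 1 ≤ (2 / a * t) ^ s := by
        refine Real.one_le_rpow ?_ hs.le
        rw [div_mul_eq_mul_div, le_div_iff₀ ha]
        linarith
      rw [Real.mul_rpow (by positivity) (by linarith)] at this
      rw [mul_assoc]
      exact le_mul_of_one_le_right (by positivity) this
    have h2 : ‖(f₀ + f₁) y‖ₑ ^ q ≤ ENNReal.ofReal (b ^ q) := by
      rw [← ofReal_norm, ENNReal.ofReal_rpow_of_nonneg (norm_nonneg _) hq.le]
      exact ENNReal.ofReal_le_ofReal (Real.rpow_le_rpow (norm_nonneg _) hmem.2 hq.le)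
    have h3 : a ≤ ‖f₀ y‖ + ‖f₁ y‖ := by
      refine hmem.1.trans ?_
      rw [hadd]
      exact norm_add_le _ _
    refine h2.trans ?_
    rw [← ofReal_norm, ← ofReal_norm, ENNReal.ofReal_rpow_of_nonneg (norm_nonneg _) hq₀.le,
      ENNReal.ofReal_rpow_of_nonneg (norm_nonneg _) hq₁.le, ← ENNReal.ofReal_mul (by positivity),
      ← ENNReal.ofReal_mul (by positivity)]
    rcases le_or_gt (a / 2) ‖f₀ y‖ with h | h
    · exact le_add_right (ENNReal.ofReal_le_ofReal (h1 hq₀ h))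
    · exact le_add_left (ENNReal.ofReal_le_ofReal (h1 hq₁ (by linarith)))
  · rw [Set.indicator_of_notMem hmem]
    simp [hq]

lemma tendsto_supMass_truncation (hq₀ : 0 < q₀) (hq₁ : 0 < q₁) (hq : 0 < q)
    {l : Filter ℝ} {c : ℝ → EuclideanSpace ℝ (Fin n) → ℝ≥0∞}
    {S : ℝ → EuclideanSpace ℝ (Fin n) → Set (EuclideanSpace ℝ (Fin n))} {f₀ f₁ : FunClass n}
    (h₀ : Tendsto (fun i => supMass (c i) (S i) (fun y => ‖f₀ y‖ₑ ^ q₀)) l (𝓝 0))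
    (h₁ : Tendsto (fun i => supMass (c i) (S i) (fun y => ‖f₁ y‖ₑ ^ q₁)) l (𝓝 0))
    {a b : ℝ} (ha : 0 < a) (hb : 0 < b) :
    Tendsto (fun i => supMass (c i) (S i) (fun y => ‖truncation a b (f₀ + f₁) y‖ₑ ^ q)) l
      (𝓝 0) := by
  have h := (ENNReal.Tendsto.const_mul h₀ (Or.inr (ENNReal.ofReal_ne_top
    (r := b ^ q * (2 / a) ^ q₀)))).add (ENNReal.Tendsto.const_mul h₁ (Or.inr
    (ENNReal.ofReal_ne_top (r := b ^ q * (2 / a) ^ q₁))))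
  rw [mul_zero, mul_zero, add_zero] at h
  refine tendsto_of_tendsto_of_tendsto_of_le_of_le tendsto_const_nhds h (fun _ => zero_le)
    fun i => ?_
  refine (supMass_mono_ae (enorm_truncation_add_le hq₀ hq₁ hq ha hb)).trans ?_
  refine (supMass_add_le ((f₀.stronglyMeasurable.enorm.pow_const q₀).const_mul _)).trans_eq ?_
  rw [supMass_const_mul ENNReal.ofReal_ne_top, supMass_const_mul ENNReal.ofReal_ne_top]

end Subset

/-! ### The integral kernel of the interpolating family -/

/-- `∫_1^z e^{-aζ} dζ` in closed form. The base point `1` makes the kernel of size `e^{-a}` on the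
line `Re z = 1`. -/
def stripKernel (a : ℝ) (z : ℂ) : ℂ :=
  if a = 0 then z - 1 else (Complex.exp (-a) - Complex.exp (-a * z)) / a

lemma stripKernel_one (a : ℝ) : stripKernel a 1 = 0 := by
  simp [stripKernel]

lemma measurable_stripKernel (z : ℂ) : Measurable fun a => stripKernel a z := by
  unfold stripKernel
  refine Measurable.ite (measurableSet_singleton (0 : ℝ)) measurable_const ?_
  fun_prop

lemma hasDerivAt_exp_neg_mul (a : ℝ) (z : ℂ) :
    HasDerivAt (fun z : ℂ => Complex.exp (-a * z)) (Complex.exp (-a * z) * -a) z := by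
  simpa using ((hasDerivAt_id z).const_mul (-a : ℂ)).cexp

lemma hasDerivAt_stripKernel (a : ℝ) (z : ℂ) :
    HasDerivAt (stripKernel a) (Complex.exp (-a * z)) z := by
  rcases eq_or_ne a 0 with rfl | ha
  · have h : stripKernel 0 = fun z => z - 1 := by
      funext z; simp [stripKernel]
    rw [h]
    simpa using (hasDerivAt_id' z).sub_const (1 : ℂ)
  · have h : stripKernel a = fun z => (Complex.exp (-a) - Complex.exp (-a * z)) / a := by
      funext z; simp [stripKernel, ha]
    rw [h]
    have ha' : (a : ℂ) ≠ 0 := by exact_mod_cast ha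
    refine (((hasDerivAt_exp_neg_mul a z).const_sub (Complex.exp (-a))).div_const
      (a : ℂ)).congr_deriv ?_
    rw [mul_neg, neg_neg, mul_div_cancel_right₀ _ ha']

lemma norm_exp_neg_mul (a : ℝ) (z : ℂ) : ‖Complex.exp (-a * z)‖ = Real.exp (-a * z.re) := by
  rw [Complex.norm_exp, ← Complex.ofReal_neg, Complex.re_ofReal_mul]

lemma norm_stripKernel_sub_le {a : ℝ} (ha : 0 ≤ a) {δ : ℝ} {z w : ℂ} (hz : δ ≤ z.re)
    (hw : δ ≤ w.re) :
    ‖stripKernel a z - stripKernel a w‖ ≤ Real.exp (-a * δ) * ‖z - w‖ := by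
  refine (convex_halfSpace_re_ge δ).norm_image_sub_le_of_norm_hasDerivWithin_le
    (fun u _ => (hasDerivAt_stripKernel a u).hasDerivWithinAt) (fun u hu => ?_) hw hz
  rw [norm_exp_neg_mul, Real.exp_le_exp]
  exact mul_le_mul_of_nonpos_left hu (by linarith)

/-- A second order Taylor bound uniform in `a ≥ 0`: the second derivative `a e^{-aζ}` is bounded by
`1/δ` on `Re ζ ≥ δ`. -/
lemma norm_stripKernel_taylor_le {a : ℝ} (ha : 0 ≤ a) {δ : ℝ} (hδ : 0 < δ) {z w : ℂ}
    (hz : δ ≤ z.re) (hw : δ ≤ w.re) :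
    ‖stripKernel a w - stripKernel a z - (w - z) * Complex.exp (-a * z)‖ ≤
      δ⁻¹ * ‖w - z‖ * ‖w - z‖ := by
  have hexp : ∀ u : ℂ, δ ≤ u.re →
      ‖Complex.exp (-a * u) - Complex.exp (-a * z)‖ ≤ δ⁻¹ * ‖u - z‖ := by
    intro u hu
    refine (convex_halfSpace_re_ge δ).norm_image_sub_le_of_norm_hasDerivWithin_le
      (fun u _ => (hasDerivAt_exp_neg_mul a u).hasDerivWithinAt) (fun u hu => ?_) hz hu
    rw [norm_mul, norm_exp_neg_mul, norm_neg, Complex.norm_real, Real.norm_of_nonneg ha]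
    have h1 : Real.exp (-a * u.re) ≤ Real.exp (-(a * δ)) := by
      rw [Real.exp_le_exp, neg_mul]
      exact neg_le_neg (mul_le_mul_of_nonneg_left hu ha)
    have h2 : a * δ ≤ Real.exp (a * δ) := by linarith [Real.add_one_le_exp (a * δ)]
    calc Real.exp (-a * u.re) * a ≤ Real.exp (-(a * δ)) * a := by gcongr
      _ = Real.exp (-(a * δ)) * (a * δ) * δ⁻¹ := by field_simp
      _ ≤ Real.exp (-(a * δ)) * Real.exp (a * δ) * δ⁻¹ := by gcongr
      _ = δ⁻¹ := by rw [← Real.exp_add]; simp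
  have hconv : Convex ℝ ({u : ℂ | δ ≤ u.re} ∩ Metric.closedBall z ‖w - z‖) :=
    (convex_halfSpace_re_ge δ).inter (convex_closedBall _ _)
  have hder : ∀ u : ℂ, HasDerivAt (fun u => stripKernel a u - u * Complex.exp (-a * z))
      (Complex.exp (-a * u) - Complex.exp (-a * z)) u := fun u => by
    have h := (hasDerivAt_stripKernel a u).fun_sub
      ((hasDerivAt_id' u).mul_const (Complex.exp (-a * z)))
    rwa [one_mul] at h
  have h := hconv.norm_image_sub_le_of_norm_hasDerivWithin_le
    (fun u _ => (hder u).hasDerivWithinAt) (C := δ⁻¹ * ‖w - z‖) (fun u hu => ?_)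
    (x := z) (y := w) ⟨hz, by simp⟩ ⟨hw, by simp [dist_eq_norm]⟩
  · have e : stripKernel a w - stripKernel a z - (w - z) * Complex.exp (-a * z)
        = stripKernel a w - w * Complex.exp (-a * z)
          - (stripKernel a z - z * Complex.exp (-a * z)) := by ring
    rw [e]
    exact h
  · refine (hexp u hu.1).trans ?_
    have := mem_closedBall_iff_norm.1 hu.2
    gcongr

lemma mul_norm_stripKernel_le {a : ℝ} (ha : 0 ≤ a) {δ : ℝ} (hδ : δ ≤ 1) {z : ℂ}
    (hz : δ ≤ z.re) : ‖stripKernel a z‖ * a ≤ 2 * Real.exp (-a * δ) := by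
  rcases eq_or_ne a 0 with rfl | h0
  · simp
  · have hpos : 0 < a := lt_of_le_of_ne ha (Ne.symm h0)
    rw [stripKernel, if_neg h0, norm_div, Complex.norm_real, Real.norm_of_nonneg ha,
      div_mul_cancel₀ _ h0]
    refine (norm_sub_le _ _).trans ?_
    have h1 : ‖Complex.exp (-a)‖ = Real.exp (-a * 1) := by
      simpa using norm_exp_neg_mul a 1
    rw [h1, norm_exp_neg_mul, two_mul]
    refine add_le_add (Real.exp_le_exp.2 ?_) (Real.exp_le_exp.2 ?_)
    · exact mul_le_mul_of_nonpos_left hδ (by linarith)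
    · exact mul_le_mul_of_nonpos_left hz (by linarith)

/-- `sgn(w) |w|^α`, which is `0` at `w = 0`. -/
def phasePow (α : ℝ) (w : ℂ) : ℂ := w / ‖w‖ * ((‖w‖ ^ α : ℝ) : ℂ)

lemma measurable_phasePow (α : ℝ) : Measurable (phasePow α) := by
  unfold phasePow
  fun_prop

lemma norm_phasePow_le (α : ℝ) (w : ℂ) : ‖phasePow α w‖ ≤ ‖w‖ ^ α := by
  have h0 : 0 ≤ ‖w‖ ^ α := Real.rpow_nonneg (norm_nonneg _) _
  rw [phasePow, norm_mul, norm_div, Complex.norm_real, Complex.norm_real, norm_norm,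
    Real.norm_of_nonneg h0]
  exact mul_le_of_le_one_left h0 (div_self_le_one _)

lemma phasePow_zero (α : ℝ) : phasePow α 0 = 0 := by simp [phasePow]

lemma rpow_mul_exp_log (α β : ℝ) {t : ℝ} (ht : 0 < t) (x : ℝ) :
    t ^ α * Real.exp ((β - α) * Real.log t * x) = t ^ (α + (β - α) * x) := by
  rw [Real.rpow_add ht, mul_right_comm, Real.rpow_def_of_pos ht ((β - α) * x)]
  ring_nf

lemma norm_phasePow_mul_exp_le (α β : ℝ) (w : ℂ) :
    ‖phasePow α w‖ * Real.exp ((β - α) * Real.log ‖w‖) ≤ ‖w‖ ^ β := by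
  rcases eq_or_ne w 0 with rfl | hw
  · rw [phasePow_zero, norm_zero, zero_mul]
    exact Real.rpow_nonneg le_rfl _
  · have h := rpow_mul_exp_log α β (norm_pos_iff.2 hw) 1
    rw [mul_one, mul_one, add_sub_cancel] at h
    rw [← h]
    exact mul_le_mul_of_nonneg_right (norm_phasePow_le α w) (Real.exp_pos _).le

lemma phasePow_mul_exp {α β x : ℝ} (h : α + (β - α) * x = 1) (w : ℂ) :
    phasePow α w * Complex.exp (((β - α) * Real.log ‖w‖ : ℝ) * x) = w := by
  rcases eq_or_ne w 0 with rfl | hw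
  · rw [phasePow_zero, zero_mul]
  · have h1 := rpow_mul_exp_log α β (norm_pos_iff.2 hw) x
    rw [h, Real.rpow_one] at h1
    have h2 : ((‖w‖ ^ α : ℝ) : ℂ) * Complex.exp (((β - α) * Real.log ‖w‖ : ℝ) * x) = ‖w‖ := by
      rw [← Complex.ofReal_mul, ← Complex.ofReal_exp, ← Complex.ofReal_mul, h1]
    rw [phasePow, mul_assoc, h2]
    exact div_mul_cancel₀ _ (by simpa using hw)

/-- The number `a = -(β - α) log |w|`, for which `|w|^β = |w|^α e^{-a}` when `w ≠ 0`. -/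
def rate (α β : ℝ) (w : ℂ) : ℝ := -((β - α) * Real.log ‖w‖)

lemma measurable_rate (α β : ℝ) : Measurable (rate α β) := by
  unfold rate
  exact ((Real.measurable_log.comp measurable_norm).const_mul _).neg

/-- `χ_A(w) ∫_1^z sgn(w) |w|^{(1-ζ)α + ζβ} dζ`, used for sets `A` on which `|w|^β ≤ |w|^α`. There it
is bounded by `|w|^α` on the strip and by `|w|^β` on `Re z = 1`, and in both cases a factor
`1 / |log |w||` can be gained. -/
def interpPiece (A : Set ℂ) (α β : ℝ) (z w : ℂ) : ℂ :=
  A.indicator (fun w => phasePow α w * stripKernel (rate α β w) z) w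

/-- The derivative `χ_A(w) sgn(w) |w|^{(1-z)α + zβ}` of `z ↦ interpPiece A α β z w`. -/
def interpDeriv (A : Set ℂ) (α β : ℝ) (z w : ℂ) : ℂ :=
  A.indicator (fun w => phasePow α w * Complex.exp (-rate α β w * z)) w

section Piece

variable {A : Set ℂ} {α β : ℝ}

lemma measurable_interpPiece (hA : MeasurableSet A) (z : ℂ) :
    Measurable (interpPiece A α β z) :=
  ((measurable_phasePow α).mul
    ((measurable_stripKernel z).comp (measurable_rate α β))).indicator hA

lemma measurable_interpDeriv (hA : MeasurableSet A) (z : ℂ) :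
    Measurable (interpDeriv A α β z) := by
  refine ((measurable_phasePow α).mul ?_).indicator hA
  have := measurable_rate α β
  fun_prop

lemma interpPiece_one (w : ℂ) : interpPiece A α β 1 w = 0 := by
  simp [interpPiece, stripKernel_one]

lemma abs_rate (w : ℂ) : |rate α β w| = |β - α| * |Real.log ‖w‖| := by
  rw [rate, abs_neg, abs_mul]

lemma norm_interpPiece_sub_le (hA : ∀ w ∈ A, 0 ≤ rate α β w)
    {z z' : ℂ} (hz : 0 ≤ z.re) (hz' : 0 ≤ z'.re) (w : ℂ) :
    ‖interpPiece A α β z w - interpPiece A α β z' w‖ ≤ ‖z - z'‖ * ‖w‖ ^ α := by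
  by_cases hw : w ∈ A
  · simp only [interpPiece, Set.indicator_of_mem hw]
    rw [← mul_sub, norm_mul, mul_comm]
    have h := norm_stripKernel_sub_le (hA w hw) hz hz'
    rw [mul_zero, Real.exp_zero, one_mul] at h
    exact mul_le_mul h (norm_phasePow_le α w) (norm_nonneg _) (norm_nonneg _)
  · simp only [interpPiece, Set.indicator_of_notMem hw, sub_zero, norm_zero]
    positivity

lemma norm_interpPiece_sub_le_of_one_le (hA : ∀ w ∈ A, 0 ≤ rate α β w)
    {z z' : ℂ} (hz : 1 ≤ z.re) (hz' : 1 ≤ z'.re) (w : ℂ) :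
    ‖interpPiece A α β z w - interpPiece A α β z' w‖ ≤ ‖z - z'‖ * ‖w‖ ^ β := by
  by_cases hw : w ∈ A
  · simp only [interpPiece, Set.indicator_of_mem hw]
    rw [← mul_sub, norm_mul]
    have h := norm_stripKernel_sub_le (hA w hw) hz hz'
    have h2 := norm_phasePow_mul_exp_le α β w
    have e : -rate α β w * 1 = (β - α) * Real.log ‖w‖ := by rw [rate]; ring
    rw [e] at h
    calc _ ≤ ‖phasePow α w‖ * (Real.exp ((β - α) * Real.log ‖w‖) * ‖z - z'‖) := by gcongr
      _ = ‖z - z'‖ * (‖phasePow α w‖ * Real.exp ((β - α) * Real.log ‖w‖)) := by ring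
      _ ≤ _ := by gcongr
  · simp only [interpPiece, Set.indicator_of_notMem hw, sub_zero, norm_zero]
    positivity

lemma norm_interpPiece_mul_log_le (hA : ∀ w ∈ A, 0 ≤ rate α β w)
    (hne : α ≠ β) {z : ℂ} (hz : 0 ≤ z.re) (w : ℂ) :
    ‖interpPiece A α β z w‖ * |Real.log ‖w‖| ≤ 2 / |β - α| * ‖w‖ ^ α := by
  have hpos : 0 < |β - α| := abs_pos.2 (sub_ne_zero.2 hne.symm)
  by_cases hw : w ∈ A
  · simp only [interpPiece, Set.indicator_of_mem hw]
    have h := mul_norm_stripKernel_le (hA w hw) zero_le_one hz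
    have h3 : rate α β w = |β - α| * |Real.log ‖w‖| := by
      rw [← abs_rate, abs_of_nonneg (hA w hw)]
    rw [mul_zero, Real.exp_zero, mul_one] at h
    rw [norm_mul, div_mul_eq_mul_div, le_div_iff₀ hpos]
    calc _ = ‖stripKernel (rate α β w) z‖ * (|β - α| * |Real.log ‖w‖|) * ‖phasePow α w‖ := by ring
      _ = ‖stripKernel (rate α β w) z‖ * rate α β w * ‖phasePow α w‖ := by rw [← h3]
      _ ≤ 2 * ‖w‖ ^ α := mul_le_mul h (norm_phasePow_le α w) (norm_nonneg _) zero_le_two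
  · simp only [interpPiece, Set.indicator_of_notMem hw, norm_zero, zero_mul]
    positivity

lemma norm_interpPiece_mul_log_le_of_one_le (hA : ∀ w ∈ A, 0 ≤ rate α β w)
    (hne : α ≠ β) {z : ℂ} (hz : 1 ≤ z.re) (w : ℂ) :
    ‖interpPiece A α β z w‖ * |Real.log ‖w‖| ≤ 2 / |β - α| * ‖w‖ ^ β := by
  have hpos : 0 < |β - α| := abs_pos.2 (sub_ne_zero.2 hne.symm)
  by_cases hw : w ∈ A
  · simp only [interpPiece, Set.indicator_of_mem hw]
    have h := mul_norm_stripKernel_le (hA w hw) le_rfl hz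
    have e : -rate α β w * 1 = (β - α) * Real.log ‖w‖ := by rw [rate]; ring
    have h3 : rate α β w = |β - α| * |Real.log ‖w‖| := by
      rw [← abs_rate, abs_of_nonneg (hA w hw)]
    rw [e] at h
    have h2 := norm_phasePow_mul_exp_le α β w
    rw [norm_mul, div_mul_eq_mul_div, le_div_iff₀ hpos]
    calc _ = ‖phasePow α w‖ * (‖stripKernel (rate α β w) z‖ * (|β - α| * |Real.log ‖w‖|)) := by ring
      _ = ‖phasePow α w‖ * (‖stripKernel (rate α β w) z‖ * rate α β w) := by rw [← h3]
      _ ≤ ‖phasePow α w‖ * (2 * Real.exp ((β - α) * Real.log ‖w‖)) := by gcongr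
      _ = 2 * (‖phasePow α w‖ * Real.exp ((β - α) * Real.log ‖w‖)) := by ring
      _ ≤ _ := by gcongr
  · simp only [interpPiece, Set.indicator_of_notMem hw, norm_zero, zero_mul]
    positivity

lemma norm_interpPiece_taylor_le (hA : ∀ w ∈ A, 0 ≤ rate α β w)
    {δ : ℝ} (hδ : 0 < δ) {z z' : ℂ} (hz : δ ≤ z.re)
    (hz' : δ ≤ z'.re) (w : ℂ) :
    ‖interpPiece A α β z' w - interpPiece A α β z w - (z' - z) * interpDeriv A α β z w‖
      ≤ δ⁻¹ * ‖z' - z‖ * ‖z' - z‖ * ‖w‖ ^ α := by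
  by_cases hw : w ∈ A
  · simp only [interpPiece, interpDeriv, Set.indicator_of_mem hw]
    have h := norm_stripKernel_taylor_le (hA w hw) hδ hz hz'
    have e : phasePow α w * stripKernel (rate α β w) z' - phasePow α w * stripKernel (rate α β w) z
        - (z' - z) * (phasePow α w * Complex.exp (-rate α β w * z))
        = (stripKernel (rate α β w) z' - stripKernel (rate α β w) z
          - (z' - z) * Complex.exp (-rate α β w * z)) * phasePow α w := by ring
    rw [e, norm_mul]
    exact mul_le_mul h (norm_phasePow_le α w) (norm_nonneg _) (by positivity)
  · simp only [interpPiece, interpDeriv, Set.indicator_of_notMem hw, mul_zero, sub_zero, norm_zero]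
    positivity

lemma norm_interpDeriv_le (hA : ∀ w ∈ A, 0 ≤ rate α β w) {z : ℂ} (hz : 0 ≤ z.re) (w : ℂ) :
    ‖interpDeriv A α β z w‖ ≤ ‖w‖ ^ α := by
  by_cases hw : w ∈ A
  · simp only [interpDeriv, Set.indicator_of_mem hw]
    rw [norm_mul, norm_exp_neg_mul]
    have h1 : Real.exp (-rate α β w * z.re) ≤ 1 := by
      rw [Real.exp_le_one_iff, neg_mul]
      exact neg_nonpos.2 (mul_nonneg (hA w hw) hz)
    exact (mul_le_of_le_one_right (norm_nonneg _) h1).trans (norm_phasePow_le α w)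
  · simp only [interpDeriv, Set.indicator_of_notMem hw, norm_zero]
    positivity

lemma norm_interpDeriv_mul_log_le (hA : ∀ w ∈ A, 0 ≤ rate α β w)
    (hne : α ≠ β) {z : ℂ} (hz : 0 < z.re) (w : ℂ) :
    ‖interpDeriv A α β z w‖ * |Real.log ‖w‖| ≤ (|β - α| * z.re)⁻¹ * ‖w‖ ^ α := by
  have hpos : 0 < |β - α| := abs_pos.2 (sub_ne_zero.2 hne.symm)
  by_cases hw : w ∈ A
  · simp only [interpDeriv, Set.indicator_of_mem hw]
    rw [norm_mul, norm_exp_neg_mul]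
    have h3 : rate α β w = |β - α| * |Real.log ‖w‖| := by
      rw [← abs_rate, abs_of_nonneg (hA w hw)]
    set m := rate α β w * z.re with hm
    have h1 : Real.exp (-rate α β w * z.re) * m ≤ 1 := by
      have : m ≤ Real.exp m := by linarith [Real.add_one_le_exp m]
      rw [neg_mul, ← hm]
      calc Real.exp (-m) * m ≤ Real.exp (-m) * Real.exp m := by gcongr
        _ = 1 := by rw [← Real.exp_add]; simp
    rw [← div_eq_inv_mul, le_div_iff₀ (by positivity)]
    calc _ = ‖phasePow α w‖ * (Real.exp (-rate α β w * z.re) *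
          (|β - α| * |Real.log ‖w‖| * z.re)) := by ring
      _ = ‖phasePow α w‖ * (Real.exp (-rate α β w * z.re) * m) := by rw [← h3]
      _ ≤ ‖phasePow α w‖ := mul_le_of_le_one_right (norm_nonneg _) h1
      _ ≤ _ := norm_phasePow_le α w
  · simp only [interpDeriv, Set.indicator_of_notMem hw, norm_zero, zero_mul]
    positivity

end Piece

/-! ### Construction of the interpolating function -/

section Membership

variable {q q' σ α : ℝ} {l : Filter ℝ}
  {c : ℝ → EuclideanSpace ℝ (Fin n) → ℝ≥0∞}
  {S : ℝ → EuclideanSpace ℝ (Fin n) → Set (EuclideanSpace ℝ (Fin n))}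

/-- Splitting according to `|log |f|| ≤ M`, that is `e^{-M} ≤ |f| ≤ e^M`: outside this set the decay
`|F| ≤ C |f|^α / |log |f||` gives a small constant, inside `F` is controlled by a truncation. -/
lemma enorm_rpow_le_add_truncation (hq' : 0 < q') (hα : 0 < α) (hαq : α * q' = q)
    {f F : FunClass n} {C M : ℝ≥0} (hM : 0 < M) (h₁ : ∀ᵐ y, ‖F y‖ ≤ C * ‖f y‖ ^ α)
    (h₂ : ∀ᵐ y, ‖F y‖ * |Real.log ‖f y‖| ≤ C * ‖f y‖ ^ α) :
    ∀ᵐ y, ‖F y‖ₑ ^ q' ≤ ((C / M : ℝ≥0) : ℝ≥0∞) ^ q' * ‖f y‖ₑ ^ q +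
      (C : ℝ≥0∞) ^ q' * ‖truncation (Real.exp (-M)) (Real.exp M) f y‖ₑ ^ q := by
  filter_upwards [h₁, h₂, coeFn_truncation (Real.exp (-M)) (Real.exp M) f] with y hy₁ hy₂ ht
  rcases eq_or_ne (f y) 0 with h0 | h0
  -- where `f = 0`, the junk value `log 0 = 0` is harmless because `F` vanishes there
  · have hF : F y = 0 := by
      rw [h0, norm_zero, Real.zero_rpow hα.ne', mul_zero] at hy₁
      exact norm_le_zero_iff.1 hy₁
    rw [hF, enorm_zero, ENNReal.zero_rpow_of_pos hq']
    exact zero_le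
  rcases le_or_gt |Real.log ‖f y‖| M with hlog | hlog
  · have hmem : y ∈ {y | Real.exp (-M) ≤ ‖f y‖ ∧ ‖f y‖ ≤ Real.exp M} := by
      have hpos := norm_pos_iff.2 h0
      obtain ⟨ha, hb⟩ := abs_le.1 hlog
      exact ⟨(Real.le_log_iff_exp_le hpos).1 ha, (Real.log_le_iff_le_exp hpos).1 hb⟩
    rw [ht, Set.indicator_of_mem hmem]
    exact le_add_left (enorm_rpow_le_of_norm_le hq' hα hαq hy₁)
  · refine le_add_right (enorm_rpow_le_of_norm_le hq' hα hαq ?_)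
    have hM' : (0 : ℝ) < M := hM
    push_cast
    rw [div_mul_eq_mul_div, le_div_iff₀ hM']
    exact (mul_le_mul_of_nonneg_left hlog.le (norm_nonneg _)).trans hy₂

lemma tendsto_supMass_of_log_decay {K : ℝ≥0}
    (hK : ∀ᶠ i in l, ∀ φ, supMass (c i) (S i) φ ≤ K * morreyMass σ φ)
    (hq' : 0 < q') (hα : 0 < α) (hαq : α * q' = q) {f F : FunClass n}
    (hf : morreyMass σ (fun y => ‖f y‖ₑ ^ q) < ∞)
    (ht : ∀ a b : ℝ, 0 < a → a < b →
      Tendsto (fun i => supMass (c i) (S i) (fun y => ‖truncation a b f y‖ₑ ^ q)) l (𝓝 0))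
    {C : ℝ≥0} (h₁ : ∀ᵐ y, ‖F y‖ ≤ C * ‖f y‖ ^ α)
    (h₂ : ∀ᵐ y, ‖F y‖ * |Real.log ‖f y‖| ≤ C * ‖f y‖ ^ α) :
    Tendsto (fun i => supMass (c i) (S i) (fun y => ‖F y‖ₑ ^ q')) l (𝓝 0) := by
  set T := morreyMass σ (fun y => ‖f y‖ₑ ^ q) with hT
  rw [ENNReal.tendsto_nhds_zero]
  intro ε hε
  have hε2 : 0 < ε / 2 := ENNReal.half_pos hε.ne'
  have hlim : Tendsto (fun M : ℝ≥0 => ((C / M : ℝ≥0) : ℝ≥0∞) ^ q' * (K * T)) atTop (𝓝 0) := by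
    have h0 : Tendsto (fun M : ℝ≥0 => (C : ℝ) / M) atTop (𝓝 0) :=
      tendsto_const_nhds.div_atTop (NNReal.tendsto_coe_atTop.2 tendsto_id)
    have h1 : Tendsto (fun M : ℝ≥0 => C / M) atTop (𝓝 0) := by
      rw [← NNReal.tendsto_coe]
      simpa using h0
    have h2 : Tendsto (fun M : ℝ≥0 => ((C / M : ℝ≥0) : ℝ≥0∞)) atTop (𝓝 ((0 : ℝ≥0) : ℝ≥0∞)) :=
      ENNReal.tendsto_coe.2 h1
    rw [ENNReal.coe_zero] at h2
    have h3 := (ENNReal.continuous_rpow_const (y := q')).continuousAt.tendsto.comp h2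
    rw [ENNReal.zero_rpow_of_pos hq'] at h3
    have h4 := ENNReal.Tendsto.mul_const h3
      (Or.inr (ENNReal.mul_ne_top (ENNReal.coe_ne_top (r := K)) hf.ne))
    rwa [zero_mul] at h4
  obtain ⟨M, hM, hM0⟩ := ((ENNReal.tendsto_nhds_zero.1 hlim _ hε2).and
    (eventually_gt_atTop 0)).exists
  have hexp : Real.exp (-M) < Real.exp M := by
    rw [Real.exp_lt_exp]
    have : (0 : ℝ) < M := hM0
    linarith
  have h3 := ENNReal.Tendsto.const_mul (ht _ _ (Real.exp_pos _) hexp)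
    (Or.inr (ENNReal.rpow_ne_top_of_nonneg hq'.le (ENNReal.coe_ne_top (r := C))))
  rw [mul_zero] at h3
  filter_upwards [hK, ENNReal.tendsto_nhds_zero.1 h3 _ hε2] with i hi hi2
  refine (supMass_mono_ae (enorm_rpow_le_add_truncation hq' hα hαq hM0 h₁ h₂)).trans ?_
  refine (supMass_add_le ((f.stronglyMeasurable.enorm.pow_const q).const_mul _)).trans ?_
  rw [supMass_const_mul (ENNReal.rpow_ne_top_of_nonneg hq'.le ENNReal.coe_ne_top),
    supMass_const_mul (ENNReal.rpow_ne_top_of_nonneg hq'.le ENNReal.coe_ne_top)]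
  refine (add_le_add ?_ hi2).trans_eq (ENNReal.add_halves ε)
  exact (mul_le_mul_right (hi _) _).trans hM

end Membership

/-- `X` is the subspace of the Morrey space `M^p_q`, with its norm, of all `f` for which
`supMass (c i) (S i) (|f|^q)` tends to `0` along `l`. -/
structure IsVanishingMorrey (X : NormedSubspace (FunClass n)) (p q : ℝ) (l : Filter ℝ)
    (c : ℝ → EuclideanSpace ℝ (Fin n) → ℝ≥0∞)
    (S : ℝ → EuclideanSpace ℝ (Fin n) → Set (EuclideanSpace ℝ (Fin n))) : Prop where
  nrm_eq : X.nrm = morreyNorm p q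
  mem_iff : ∀ f : FunClass n, f ∈ X.carrier ↔ MemMorrey p q f ∧
    Tendsto (fun i => supMass (c i) (S i) (fun y => ‖f y‖ₑ ^ q)) l (𝓝 0)

lemma NormedSubspace.sumNorm_le {Z : Type*} [AddCommGroup Z] [Module ℂ Z]
    {X₀ X₁ : NormedSubspace Z} {a b : Z} (ha : a ∈ X₀.carrier) (hb : b ∈ X₁.carrier) :
    X₀.sumNorm X₁ (a + b) ≤ X₀.nrm a + X₁.nrm b :=
  iInf₂_le_of_le a ha (iInf₂_le_of_le b hb (iInf_le _ rfl))

section PieceClass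

variable {A : Set ℂ} {α β q p' q' σ : ℝ}

/-- The class of `y ↦ interpPiece A α β z (f y)`. -/
def pieceClass (A : Set ℂ) (hA : MeasurableSet A) (α β : ℝ) (z : ℂ) (f : FunClass n) :
    FunClass n :=
  AEEqFun.compMeasurable (interpPiece A α β z) (measurable_interpPiece hA z) f

/-- The class of `y ↦ interpDeriv A α β z (f y)`. -/
def derivClass (A : Set ℂ) (hA : MeasurableSet A) (α β : ℝ) (z : ℂ) (f : FunClass n) :
    FunClass n :=
  AEEqFun.compMeasurable (interpDeriv A α β z) (measurable_interpDeriv hA z) f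

variable (hAm : MeasurableSet A) (f : FunClass n)

lemma coeFn_pieceClass (z : ℂ) :
    ∀ᵐ y, pieceClass A hAm α β z f y = interpPiece A α β z (f y) :=
  AEEqFun.coeFn_compMeasurable _ _ f

lemma coeFn_derivClass (z : ℂ) :
    ∀ᵐ y, derivClass A hAm α β z f y = interpDeriv A α β z (f y) :=
  AEEqFun.coeFn_compMeasurable _ _ f

lemma morreyNorm_pieceClass_sub_le (hA : ∀ w ∈ A, 0 ≤ rate α β w) (hp' : 0 < p') (hq' : 0 < q')
    (hσ' : q' / p' = σ) (hα : 0 < α) (hαq : α * q' = q) {z z' : ℂ}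
    (hz : 0 ≤ z.re) (hz' : 0 ≤ z'.re) :
    morreyNorm p' q' (pieceClass A hAm α β z f - pieceClass A hAm α β z' f) ≤
      ‖z - z'‖ₑ * morreyMass σ (fun y => ‖f y‖ₑ ^ q) ^ (1 / q') := by
  refine morreyNorm_le_of_norm_le hp' hq' hσ' hα hαq (C := ‖z - z'‖₊) ?_
  filter_upwards [coeFn_pieceClass hAm f z, coeFn_pieceClass hAm f z',
    AEEqFun.coeFn_sub (pieceClass A hAm α β z f) (pieceClass A hAm α β z' f)] with y h1 h2 h3
  rw [h3, Pi.sub_apply, h1, h2]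
  exact norm_interpPiece_sub_le hA hz hz' _

lemma morreyNorm_pieceClass_sub_le_of_one_le (hA : ∀ w ∈ A, 0 ≤ rate α β w) (hp' : 0 < p')
    (hq' : 0 < q') (hσ' : q' / p' = σ) (hβ : 0 < β) (hβq : β * q' = q) {z z' : ℂ}
    (hz : 1 ≤ z.re) (hz' : 1 ≤ z'.re) :
    morreyNorm p' q' (pieceClass A hAm α β z f - pieceClass A hAm α β z' f) ≤
      ‖z - z'‖ₑ * morreyMass σ (fun y => ‖f y‖ₑ ^ q) ^ (1 / q') := by
  refine morreyNorm_le_of_norm_le hp' hq' hσ' hβ hβq (C := ‖z - z'‖₊) ?_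
  filter_upwards [coeFn_pieceClass hAm f z, coeFn_pieceClass hAm f z',
    AEEqFun.coeFn_sub (pieceClass A hAm α β z f) (pieceClass A hAm α β z' f)] with y h1 h2 h3
  rw [h3, Pi.sub_apply, h1, h2]
  exact norm_interpPiece_sub_le_of_one_le hA hz hz' _

lemma pieceClass_one : pieceClass A hAm α β 1 f = 0 := by
  apply AEEqFun.ext
  filter_upwards [coeFn_pieceClass (α := α) (β := β) hAm f 1,
    AEEqFun.coeFn_zero (α := EuclideanSpace ℝ (Fin n)) (β := ℂ) (μ := volume)] with y h1 h2
  rw [h1, h2, interpPiece_one, Pi.zero_apply]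

lemma morreyNorm_taylor_le (hA : ∀ w ∈ A, 0 ≤ rate α β w) (hp' : 0 < p') (hq' : 0 < q')
    (hσ' : q' / p' = σ) (hα : 0 < α) (hαq : α * q' = q) {δ : ℝ} (hδ : 0 < δ) {z z' : ℂ}
    (hne : z' ≠ z) (hz : δ ≤ z.re) (hz' : δ ≤ z'.re) :
    morreyNorm p' q' ((z' - z)⁻¹ • (pieceClass A hAm α β z' f - pieceClass A hAm α β z f)
        - derivClass A hAm α β z f) ≤
      ENNReal.ofReal δ⁻¹ * ‖z' - z‖ₑ * morreyMass σ (fun y => ‖f y‖ₑ ^ q) ^ (1 / q') := by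
  have h : ∀ᵐ y, ‖((z' - z)⁻¹ • (pieceClass A hAm α β z' f - pieceClass A hAm α β z f)
      - derivClass A hAm α β z f) y‖ ≤ (Real.toNNReal δ⁻¹ * ‖z' - z‖₊ : ℝ≥0) * ‖f y‖ ^ α := by
    filter_upwards [coeFn_pieceClass hAm f z, coeFn_pieceClass hAm f z', coeFn_derivClass hAm f z,
      AEEqFun.coeFn_sub (pieceClass A hAm α β z' f) (pieceClass A hAm α β z f),
      AEEqFun.coeFn_smul (z' - z)⁻¹ (pieceClass A hAm α β z' f - pieceClass A hAm α β z f),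
      AEEqFun.coeFn_sub ((z' - z)⁻¹ • (pieceClass A hAm α β z' f - pieceClass A hAm α β z f))
        (derivClass A hAm α β z f)] with y h1 h2 h3 h4 h5 h6
    rw [h6, Pi.sub_apply, h5, Pi.smul_apply, h4, Pi.sub_apply, h1, h2, h3, smul_eq_mul]
    have hne' : z' - z ≠ 0 := sub_ne_zero.2 hne
    have hpos : 0 < ‖z' - z‖ := norm_pos_iff.2 hne'
    have ht := norm_interpPiece_taylor_le hA hδ hz hz' (f y)
    have e : (z' - z)⁻¹ * (interpPiece A α β z' (f y) - interpPiece A α β z (f y))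
        - interpDeriv A α β z (f y) = (z' - z)⁻¹ * (interpPiece A α β z' (f y)
          - interpPiece A α β z (f y) - (z' - z) * interpDeriv A α β z (f y)) := by
      field_simp
    rw [e, norm_mul, norm_inv, inv_mul_le_iff₀ hpos]
    refine ht.trans_eq ?_
    rw [NNReal.coe_mul, Real.coe_toNNReal _ (inv_nonneg.2 hδ.le), coe_nnnorm]
    ring
  have h2 := morreyNorm_le_of_norm_le hp' hq' hσ' hα hαq h
  refine h2.trans_eq ?_
  rw [ENNReal.coe_mul]
  rfl

variable {X : NormedSubspace (FunClass n)} {l : Filter ℝ}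
  {c : ℝ → EuclideanSpace ℝ (Fin n) → ℝ≥0∞}
  {S : ℝ → EuclideanSpace ℝ (Fin n) → Set (EuclideanSpace ℝ (Fin n))}

/-- A function bounded by `|f|^α min(1, 1 / |log |f||)` lies in the vanishing space, as soon as the
truncations of `f` satisfy the vanishing condition. -/
lemma mem_of_log_decay (hX : IsVanishingMorrey X p' q' l c S) {K : ℝ≥0}
    (hK : ∀ᶠ i in l, ∀ φ, supMass (c i) (S i) φ ≤ K * morreyMass σ φ)
    (hp' : 0 < p') (hq' : 0 < q') (hσ' : q' / p' = σ) (hα : 0 < α) (hαq : α * q' = q)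
    {f F : FunClass n} (hf : morreyMass σ (fun y => ‖f y‖ₑ ^ q) < ∞)
    (ht : ∀ a b : ℝ, 0 < a → a < b →
      Tendsto (fun i => supMass (c i) (S i) (fun y => ‖truncation a b f y‖ₑ ^ q)) l (𝓝 0))
    {C C' : ℝ} (h₁ : ∀ᵐ y, ‖F y‖ ≤ C * ‖f y‖ ^ α)
    (h₂ : ∀ᵐ y, ‖F y‖ * |Real.log ‖f y‖| ≤ C' * ‖f y‖ ^ α) : F ∈ X.carrier := by
  set B : ℝ≥0 := Real.toNNReal (max C C') with hB
  have hB₁ : C ≤ B := (le_max_left _ _).trans (Real.le_coe_toNNReal _)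
  have hB₂ : C' ≤ B := (le_max_right _ _).trans (Real.le_coe_toNNReal _)
  have h₁' : ∀ᵐ y, ‖F y‖ ≤ B * ‖f y‖ ^ α := h₁.mono fun y hy => hy.trans (by gcongr)
  have h₂' : ∀ᵐ y, ‖F y‖ * |Real.log ‖f y‖| ≤ B * ‖f y‖ ^ α :=
    h₂.mono fun y hy => hy.trans (by gcongr)
  refine (hX.mem_iff F).2 ⟨?_, tendsto_supMass_of_log_decay hK hq' hα hαq hf ht h₁' h₂'⟩
  exact (morreyNorm_le_of_norm_le hp' hq' hσ' hα hαq h₁').trans_lt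
    (ENNReal.mul_lt_top ENNReal.coe_lt_top (ENNReal.rpow_lt_top_of_nonneg (by positivity) hf.ne))

end PieceClass

lemma smul_sub_sub_sub_eq {Z : Type*} [AddCommGroup Z] [Module ℂ Z] (c : ℂ) (u u' v v' d d' : Z) :
    c • ((u - v) - (u' - v')) - (d + d') = (c • (u - u') - d) + (-c • (v - v') - d') := by
  module

section Superset

variable {p₀ q₀ p₁ q₁ q σ θ : ℝ} {X₀ X₁ : NormedSubspace (FunClass n)} {l : Filter ℝ}
  {c : ℝ → EuclideanSpace ℝ (Fin n) → ℝ≥0∞}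
  {S : ℝ → EuclideanSpace ℝ (Fin n) → Set (EuclideanSpace ℝ (Fin n))}

/-- With `F(ζ) = sgn(f) |f|^{(1-ζ)q/q₀ + ζq/q₁}`, so that `F(θ) = f`, the function `G` is
`∫_1^z F` where `|F(1)| ≤ |F(0)|` and `∫_0^z F` elsewhere. The second integral is rewritten by
`ζ ↦ 1 - ζ` as an integral of the first kind with the two exponents exchanged. -/
theorem mem_secondInterp (hX₀ : IsVanishingMorrey X₀ p₀ q₀ l c S)
    (hX₁ : IsVanishingMorrey X₁ p₁ q₁ l c S) {K : ℝ≥0}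
    (hK : ∀ᶠ i in l, ∀ φ, supMass (c i) (S i) φ ≤ K * morreyMass σ φ)
    (hp₀ : 0 < p₀) (hq₀ : 0 < q₀) (hσ₀ : q₀ / p₀ = σ)
    (hp₁ : 0 < p₁) (hq₁ : 0 < q₁) (hσ₁ : q₁ / p₁ = σ) (hq0 : 0 < q) (hne : q₀ ≠ q₁)
    (hθ₀ : 0 < θ) (hθ₁ : θ < 1) (hq : 1 / q = (1 - θ) / q₀ + θ / q₁)
    {f : FunClass n} (hf : morreyMass σ (fun y => ‖f y‖ₑ ^ q) < ∞)
    (ht : ∀ a b : ℝ, 0 < a → a < b →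
      Tendsto (fun i => supMass (c i) (S i) (fun y => ‖truncation a b f y‖ₑ ^ q)) l (𝓝 0)) :
    f ∈ secondInterp X₀ X₁ θ := by
  set α := q / q₀ with hα
  set β := q / q₁ with hβ
  have hα0 : 0 < α := by positivity
  have hβ0 : 0 < β := by positivity
  have hαq : α * q₀ = q := div_mul_cancel₀ _ hq₀.ne'
  have hβq : β * q₁ = q := div_mul_cancel₀ _ hq₁.ne'
  have hαβ : α ≠ β := fun h => hne (by
    rw [hα, hβ, div_eq_div_iff hq₀.ne' hq₁.ne'] at h
    exact (mul_left_cancel₀ hq0.ne' h).symm)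
  set A : Set ℂ := {w | 0 ≤ rate α β w} with hAdef
  have hAm : MeasurableSet A := measurableSet_le measurable_const (measurable_rate α β)
  have hAm' : MeasurableSet Aᶜ := hAm.compl
  have hA : ∀ w ∈ A, 0 ≤ rate α β w := fun w hw => hw
  have hA' : ∀ w ∈ Aᶜ, 0 ≤ rate β α w := fun w hw => by
    have h1 : rate α β w < 0 := not_le.1 hw
    have h2 : rate β α w = -rate α β w := by simp only [rate]; ring
    linarith
  set N₀ : ℝ≥0∞ := morreyMass σ (fun y => ‖f y‖ₑ ^ q) ^ (1 / q₀) with hN₀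
  set N₁ : ℝ≥0∞ := morreyMass σ (fun y => ‖f y‖ₑ ^ q) ^ (1 / q₁) with hN₁
  have hN₀f : N₀ ≠ ∞ := ENNReal.rpow_ne_top_of_nonneg (by positivity) hf.ne
  have hN₁f : N₁ ≠ ∞ := ENNReal.rpow_ne_top_of_nonneg (by positivity) hf.ne
  set U : ℂ → FunClass n := fun z => pieceClass A hAm α β z f with hU
  set V : ℂ → FunClass n := fun z => pieceClass Aᶜ hAm' β α z f with hV
  set dU : ℂ → FunClass n := fun z => derivClass A hAm α β z f with hdU
  set dV : ℂ → FunClass n := fun z => derivClass Aᶜ hAm' β α z f with hdV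
  have hUX : ∀ z : ℂ, 0 ≤ z.re → U z ∈ X₀.carrier := fun z hz => by
    refine mem_of_log_decay hX₀ hK hp₀ hq₀ hσ₀ hα0 hαq hf ht (C := ‖z - 1‖)
      (C' := 2 / |β - α|) ?_ ?_
    · filter_upwards [coeFn_pieceClass hAm f z] with y hy
      have h := norm_interpPiece_sub_le hA hz (z' := 1) (by simp) (f y)
      rw [interpPiece_one, sub_zero] at h
      exact hy ▸ h
    · filter_upwards [coeFn_pieceClass hAm f z] with y hy
      exact hy ▸ norm_interpPiece_mul_log_le hA hαβ hz (f y)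
  have hVX : ∀ z : ℂ, 0 ≤ z.re → V z ∈ X₁.carrier := fun z hz => by
    refine mem_of_log_decay hX₁ hK hp₁ hq₁ hσ₁ hβ0 hβq hf ht (C := ‖z - 1‖)
      (C' := 2 / |α - β|) ?_ ?_
    · filter_upwards [coeFn_pieceClass hAm' f z] with y hy
      have h := norm_interpPiece_sub_le hA' hz (z' := 1) (by simp) (f y)
      rw [interpPiece_one, sub_zero] at h
      exact hy ▸ h
    · filter_upwards [coeFn_pieceClass hAm' f z] with y hy
      exact hy ▸ norm_interpPiece_mul_log_le hA' hαβ.symm hz (f y)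
  have hUX₁ : ∀ z : ℂ, 1 ≤ z.re → U z ∈ X₁.carrier := fun z hz => by
    refine mem_of_log_decay hX₁ hK hp₁ hq₁ hσ₁ hβ0 hβq hf ht (C := ‖z - 1‖)
      (C' := 2 / |β - α|) ?_ ?_
    · filter_upwards [coeFn_pieceClass hAm f z] with y hy
      have h := norm_interpPiece_sub_le_of_one_le hA hz (z' := 1) (by simp) (f y)
      rw [interpPiece_one, sub_zero] at h
      exact hy ▸ h
    · filter_upwards [coeFn_pieceClass hAm f z] with y hy
      exact hy ▸ norm_interpPiece_mul_log_le_of_one_le hA hαβ hz (f y)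
  have hVX₀ : ∀ z : ℂ, 1 ≤ z.re → V z ∈ X₀.carrier := fun z hz => by
    refine mem_of_log_decay hX₀ hK hp₀ hq₀ hσ₀ hα0 hαq hf ht (C := ‖z - 1‖)
      (C' := 2 / |α - β|) ?_ ?_
    · filter_upwards [coeFn_pieceClass hAm' f z] with y hy
      have h := norm_interpPiece_sub_le_of_one_le hA' hz (z' := 1) (by simp) (f y)
      rw [interpPiece_one, sub_zero] at h
      exact hy ▸ h
    · filter_upwards [coeFn_pieceClass hAm' f z] with y hy
      exact hy ▸ norm_interpPiece_mul_log_le_of_one_le hA' hαβ.symm hz (f y)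
  have hdUX : ∀ z : ℂ, 0 < z.re → dU z ∈ X₀.carrier := fun z hz => by
    refine mem_of_log_decay hX₀ hK hp₀ hq₀ hσ₀ hα0 hαq hf ht (C := 1)
      (C' := (|β - α| * z.re)⁻¹) ?_ ?_
    · filter_upwards [coeFn_derivClass hAm f z] with y hy
      rw [one_mul]
      exact hy ▸ norm_interpDeriv_le hA hz.le (f y)
    · filter_upwards [coeFn_derivClass hAm f z] with y hy
      exact hy ▸ norm_interpDeriv_mul_log_le hA hαβ hz (f y)
  have hdVX : ∀ z : ℂ, 0 < z.re → dV z ∈ X₁.carrier := fun z hz => by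
    refine mem_of_log_decay hX₁ hK hp₁ hq₁ hσ₁ hβ0 hβq hf ht (C := 1)
      (C' := (|α - β| * z.re)⁻¹) ?_ ?_
    · filter_upwards [coeFn_derivClass hAm' f z] with y hy
      rw [one_mul]
      exact hy ▸ norm_interpDeriv_le hA' hz.le (f y)
    · filter_upwards [coeFn_derivClass hAm' f z] with y hy
      exact hy ▸ norm_interpDeriv_mul_log_le hA' hαβ.symm hz (f y)
  have hUn : ∀ z z' : ℂ, 0 ≤ z.re → 0 ≤ z'.re → X₀.nrm (U z - U z') ≤ ‖z - z'‖ₑ * N₀ :=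
    fun z z' hz hz' => hX₀.nrm_eq ▸
      morreyNorm_pieceClass_sub_le hAm f hA hp₀ hq₀ hσ₀ hα0 hαq hz hz'
  have hVn : ∀ z z' : ℂ, 0 ≤ z.re → 0 ≤ z'.re → X₁.nrm (V z - V z') ≤ ‖z - z'‖ₑ * N₁ :=
    fun z z' hz hz' => hX₁.nrm_eq ▸
      morreyNorm_pieceClass_sub_le hAm' f hA' hp₁ hq₁ hσ₁ hβ0 hβq hz hz'
  have hUn₁ : ∀ z z' : ℂ, 1 ≤ z.re → 1 ≤ z'.re → X₁.nrm (U z - U z') ≤ ‖z - z'‖ₑ * N₁ :=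
    fun z z' hz hz' => hX₁.nrm_eq ▸
      morreyNorm_pieceClass_sub_le_of_one_le hAm f hA hp₁ hq₁ hσ₁ hβ0 hβq hz hz'
  have hVn₀ : ∀ z z' : ℂ, 1 ≤ z.re → 1 ≤ z'.re → X₀.nrm (V z - V z') ≤ ‖z - z'‖ₑ * N₀ :=
    fun z z' hz hz' => hX₀.nrm_eq ▸
      morreyNorm_pieceClass_sub_le_of_one_le hAm' f hA' hp₀ hq₀ hσ₀ hα0 hαq hz hz'
  have hflip : ∀ {z : ℂ}, z ∈ closedStrip → 0 ≤ (1 - z).re := fun {z} hz => by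
    simpa using hz.2
  have hsube : ∀ z w : ℂ, ‖(1 - w) - (1 - z)‖ₑ = ‖z - w‖ₑ := fun z w => by
    congr 1; ring
  set G : ℂ → FunClass n := fun z => U z - V (1 - z) with hG
  have hGsub : ∀ z ∈ closedStrip, ∀ w ∈ closedStrip,
      X₀.sumNorm X₁ (G z - G w) ≤ ‖z - w‖ₑ * (N₀ + N₁) := fun z hz w hw => by
    have e : G z - G w = (U z - U w) + (V (1 - w) - V (1 - z)) := by
      simp only [hG]; abel
    rw [e, mul_add]
    refine (NormedSubspace.sumNorm_le (sub_mem (hUX z hz.1) (hUX w hw.1))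
      (sub_mem (hVX _ (hflip hw)) (hVX _ (hflip hz)))).trans (add_le_add (hUn z w hz.1 hw.1) ?_)
    exact (hVn _ _ (hflip hw) (hflip hz)).trans_eq (by rw [hsube])
  have hGmem : ∀ z ∈ closedStrip, G z ∈ X₀.carrier ⊔ X₁.carrier := fun z hz =>
    sub_mem (Submodule.mem_sup_left (hUX z hz.1)) (Submodule.mem_sup_right (hVX _ (hflip hz)))
  have hderiv : ∀ z ∈ openStrip, HasSumDerivAt X₀ X₁ G (dU z + dV (1 - z)) z := by
    intro z hz
    have hz1 : 0 < (1 - z).re := by simpa using hz.2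
    refine ⟨add_mem (Submodule.mem_sup_left (hdUX z hz.1))
      (Submodule.mem_sup_right (hdVX _ hz1)), ?_⟩
    -- half the distance to the boundary lines, so that the Taylor bound is uniform near `z`
    set δ := min (z.re / 2) ((1 - z).re / 2) with hδ
    have hδ0 : 0 < δ := lt_min (half_pos hz.1) (half_pos hz1)
    have hlim : Tendsto (fun w : ℂ => ENNReal.ofReal δ⁻¹ * ‖w - z‖ₑ * (N₀ + N₁)) (𝓝[≠] z)
        (𝓝 0) := by
      have h1 : Tendsto (fun w : ℂ => ‖w - z‖ₑ) (𝓝 z) (𝓝 0) := by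
        have : Continuous fun w : ℂ => ‖w - z‖ₑ := by fun_prop
        simpa using this.tendsto z
      have h2 := ENNReal.Tendsto.mul_const (ENNReal.Tendsto.const_mul h1
        (Or.inr (ENNReal.ofReal_ne_top (r := δ⁻¹)))) (Or.inr (ENNReal.add_ne_top.2 ⟨hN₀f, hN₁f⟩))
      rw [mul_zero, zero_mul] at h2
      exact h2.mono_left nhdsWithin_le_nhds
    refine tendsto_of_tendsto_of_tendsto_of_le_of_le' tendsto_const_nhds hlim
      (Eventually.of_forall fun _ => zero_le) ?_
    have hopen : {w : ℂ | δ < w.re} ∩ {w : ℂ | δ < (1 - w).re} ∈ 𝓝 z := by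
      refine IsOpen.mem_nhds ((isOpen_lt continuous_const Complex.continuous_re).inter
        (isOpen_lt continuous_const (Complex.continuous_re.comp (by fun_prop)))) ⟨?_, ?_⟩
      · exact (min_le_left _ _).trans_lt (half_lt_self hz.1)
      · exact (min_le_right _ _).trans_lt (half_lt_self hz1)
    filter_upwards [mem_nhdsWithin_of_mem_nhds hopen, self_mem_nhdsWithin] with w hw hwz
    have hwz' : w ≠ z := hwz
    have e : (w - z)⁻¹ • (G w - G z) - (dU z + dV (1 - z))
        = ((w - z)⁻¹ • (U w - U z) - dU z)
          + (((1 - w) - (1 - z))⁻¹ • (V (1 - w) - V (1 - z)) - dV (1 - z)) := by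
      have e1 : (1 - w) - (1 - z) = -(w - z) := by ring
      rw [e1, inv_neg]
      exact smul_sub_sub_sub_eq _ _ _ _ _ _ _
    have hw0 : 0 ≤ w.re := hδ0.le.trans (le_of_lt hw.1)
    have hw1 : 0 ≤ (1 - w).re := hδ0.le.trans (le_of_lt hw.2)
    rw [e, mul_add]
    refine (NormedSubspace.sumNorm_le
      (sub_mem (Submodule.smul_mem _ _ (sub_mem (hUX w hw0) (hUX z hz.1.le))) (hdUX z hz.1))
      (sub_mem (Submodule.smul_mem _ _ (sub_mem (hVX _ hw1) (hVX _ hz1.le)))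
        (hdVX _ hz1))).trans (add_le_add ?_ ?_)
    · exact hX₀.nrm_eq ▸ morreyNorm_taylor_le hAm f hA hp₀ hq₀ hσ₀ hα0 hαq hδ0 hwz'
        ((min_le_left _ _).trans (half_le_self hz.1.le)) (le_of_lt hw.1)
    · have h := morreyNorm_taylor_le hAm' f hA' hp₁ hq₁ hσ₁ hβ0 hβq hδ0 (z := 1 - z) (z' := 1 - w)
        (by simpa using hwz') ((min_le_right _ _).trans (half_le_self hz1.le)) (le_of_lt hw.2)
      have e3 : ‖(1 - w) - (1 - z)‖ₑ = ‖w - z‖ₑ := by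
        rw [hsube, ← enorm_neg, neg_sub]
      rw [e3] at h
      exact hX₁.nrm_eq ▸ h
  refine ⟨G, ⟨hGmem, ?_, fun z hz => ⟨_, hderiv z hz⟩, ?_, ?_, ?_⟩, ?_⟩
  · intro z hz
    have hlim : Tendsto (fun w : ℂ => ‖w - z‖ₑ * (N₀ + N₁)) (𝓝[closedStrip] z) (𝓝 0) := by
      have h1 : Tendsto (fun w : ℂ => ‖w - z‖ₑ) (𝓝 z) (𝓝 0) := by
        have : Continuous fun w : ℂ => ‖w - z‖ₑ := by fun_prop
        simpa using this.tendsto z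
      have h2 := ENNReal.Tendsto.mul_const h1 (Or.inr (ENNReal.add_ne_top.2 ⟨hN₀f, hN₁f⟩))
      rw [zero_mul] at h2
      exact h2.mono_left nhdsWithin_le_nhds
    refine tendsto_of_tendsto_of_tendsto_of_le_of_le' tendsto_const_nhds hlim
      (Eventually.of_forall fun _ => zero_le) ?_
    filter_upwards [self_mem_nhdsWithin] with w hw using hGsub w hw z hz
  · refine ⟨(N₀ + N₁).toNNReal, fun z hz => ?_⟩
    rw [ENNReal.coe_toNNReal (ENNReal.add_ne_top.2 ⟨hN₀f, hN₁f⟩), add_mul]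
    -- `U 1` and `V 1` vanish, so the growth bound is a bound for differences
    have e : G z = (U z - U 1) + (V 1 - V (1 - z)) := by
      simp only [hG, hU, hV, pieceClass_one]; abel
    rw [e]
    refine (NormedSubspace.sumNorm_le (sub_mem (hUX z hz.1) (hUX 1 (by simp)))
      (sub_mem (hVX 1 (by simp)) (hVX _ (hflip hz)))).trans (add_le_add ?_ ?_)
    · refine (hUn z 1 hz.1 (by simp)).trans ?_
      rw [mul_comm]
      gcongr
      refine enorm_sub_le.trans ?_
      rw [enorm_one, add_comm]
    · refine (hVn 1 (1 - z) (by simp) (hflip hz)).trans ?_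
      rw [mul_comm, sub_sub_cancel]
      gcongr
      exact le_add_self
  · have h0 : ∀ t : ℝ, 0 ≤ (t * Complex.I : ℂ).re := fun t => by simp
    have h1 : ∀ t : ℝ, 1 ≤ (1 - t * Complex.I : ℂ).re := fun t => by simp
    refine ⟨fun t => sub_mem (hUX _ (h0 t)) (hVX₀ _ (h1 t)), (2 * N₀).toNNReal, fun s t => ?_⟩
    rw [ENNReal.coe_toNNReal (ENNReal.mul_ne_top (by simp) hN₀f)]
    have e : G (s * Complex.I) - G (t * Complex.I) = (U (s * Complex.I) - U (t * Complex.I))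
        + (V (1 - t * Complex.I) - V (1 - s * Complex.I)) := by
      simp only [hG]; abel
    have e2 : ‖(s * Complex.I - t * Complex.I : ℂ)‖ₑ = ‖s - t‖ₑ := by
      rw [← sub_mul, ← Complex.ofReal_sub, ← ofReal_norm, ← ofReal_norm, norm_mul, Complex.norm_I,
        mul_one, Complex.norm_real]
    rw [e]
    refine (X₀.nrm_add_le _ (sub_mem (hUX _ (h0 s)) (hUX _ (h0 t))) _
      (sub_mem (hVX₀ _ (h1 t)) (hVX₀ _ (h1 s)))).trans
      ((add_le_add (hUn _ _ (h0 s) (h0 t)) (hVn₀ _ _ (h1 t) (h1 s))).trans_eq ?_)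
    rw [hsube, e2]
    ring
  · have h1 : ∀ t : ℝ, 1 ≤ (1 + t * Complex.I : ℂ).re := fun t => by simp
    have h0 : ∀ t : ℝ, 0 ≤ (1 - (1 + t * Complex.I) : ℂ).re := fun t => by simp
    refine ⟨fun t => sub_mem (hUX₁ _ (h1 t)) (hVX _ (h0 t)), (2 * N₁).toNNReal, fun s t => ?_⟩
    rw [ENNReal.coe_toNNReal (ENNReal.mul_ne_top (by simp) hN₁f)]
    have e : G (1 + s * Complex.I) - G (1 + t * Complex.I)
        = (U (1 + s * Complex.I) - U (1 + t * Complex.I))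
        + (V (1 - (1 + t * Complex.I)) - V (1 - (1 + s * Complex.I))) := by
      simp only [hG]; abel
    have e2 : ‖((1 + s * Complex.I) - (1 + t * Complex.I) : ℂ)‖ₑ = ‖s - t‖ₑ := by
      rw [add_sub_add_left_eq_sub, ← sub_mul, ← Complex.ofReal_sub, ← ofReal_norm, ← ofReal_norm,
        norm_mul, Complex.norm_I, mul_one, Complex.norm_real]
    rw [e]
    refine (X₁.nrm_add_le _ (sub_mem (hUX₁ _ (h1 s)) (hUX₁ _ (h1 t))) _
      (sub_mem (hVX _ (h0 t)) (hVX _ (h0 s)))).trans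
      ((add_le_add (hUn₁ _ _ (h1 s) (h1 t)) (hVn _ _ (h0 t) (h0 s))).trans_eq ?_)
    rw [hsube, e2]
    ring
  · have hθs : (θ : ℂ) ∈ openStrip := by simpa [openStrip] using ⟨hθ₀, hθ₁⟩
    have hfd : dU θ + dV (1 - θ) = f := by
      have hq' : α * (1 - θ) + β * θ = 1 := by
        calc α * (1 - θ) + β * θ = q * (1 / q) := by rw [hq, hα, hβ]; ring
          _ = 1 := mul_one_div_cancel hq0.ne'
      have k1 : α + (β - α) * θ = 1 := by linarith
      have k2 : β + (α - β) * (1 - θ) = 1 := by linarith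
      apply AEEqFun.ext
      filter_upwards [AEEqFun.coeFn_add (dU θ) (dV (1 - θ)),
        coeFn_derivClass (α := α) (β := β) hAm f θ,
        coeFn_derivClass (α := β) (β := α) hAm' f (1 - θ)] with y h1 h2 h3
      rw [h1, Pi.add_apply]
      simp only [hdU, hdV]
      rw [h2, h3]
      by_cases hy : f y ∈ A
      · rw [interpDeriv, interpDeriv, Set.indicator_of_mem hy,
          Set.indicator_of_notMem (by simpa using hy), add_zero]
        have := phasePow_mul_exp k1 (f y)
        rw [rate, Complex.ofReal_neg, neg_neg]
        exact this
      · rw [interpDeriv, interpDeriv, Set.indicator_of_notMem hy,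
          Set.indicator_of_mem (by simpa using hy), zero_add]
        have := phasePow_mul_exp k2 (f y)
        rw [rate, Complex.ofReal_neg, neg_neg]
        exact_mod_cast this
    have := hderiv θ hθs
    rwa [hfd] at this

end Superset

/-! ### The vanishing Morrey spaces -/

section Main

variable {p₀ q₀ p₁ q₁ q σ θ : ℝ} {X₀ X₁ : NormedSubspace (FunClass n)} {l : Filter ℝ}
  {c : ℝ → EuclideanSpace ℝ (Fin n) → ℝ≥0∞}
  {S : ℝ → EuclideanSpace ℝ (Fin n) → Set (EuclideanSpace ℝ (Fin n))}

theorem mem_secondInterp_iff (hX₀ : IsVanishingMorrey X₀ p₀ q₀ l c S)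
    (hX₁ : IsVanishingMorrey X₁ p₁ q₁ l c S) {K : ℝ≥0}
    (hK : ∀ᶠ i in l, ∀ φ, supMass (c i) (S i) φ ≤ K * morreyMass σ φ)
    (hp₀ : 0 < p₀) (hq₀ : 1 ≤ q₀) (hσ₀ : q₀ / p₀ = σ)
    (hp₁ : 0 < p₁) (hq₁ : 1 ≤ q₁) (hσ₁ : q₁ / p₁ = σ) (hq0 : 0 < q) (hne : q₀ ≠ q₁)
    (hθ₀ : 0 < θ) (hθ₁ : θ < 1) (hq : 1 / q = (1 - θ) / q₀ + θ / q₁) (f : FunClass n) :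
    f ∈ secondInterp X₀ X₁ θ ↔ morreyMass σ (fun y => ‖f y‖ₑ ^ q) < ∞ ∧
      ∀ a b : ℝ, 0 < a → a < b →
        Tendsto (fun i => supMass (c i) (S i) (fun y => ‖truncation a b f y‖ₑ ^ q)) l (𝓝 0) := by
  constructor
  · rintro ⟨G, hG, hf⟩
    refine ⟨morreyMass_lt_top_of_hasSumDerivAt hp₀ hq₀ hσ₀ hp₁ hq₁ hσ₁ hq0 hθ₀ hθ₁ hq hX₀.nrm_eq
      hX₁.nrm_eq hG hf, fun a b ha hab => ?_⟩
    obtain ⟨f₀, hf₀, f₁, hf₁, rfl⟩ := Submodule.mem_sup.1 hf.1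
    exact tendsto_supMass_truncation (by linarith) (by linarith) hq0 ((hX₀.mem_iff _).1 hf₀).2
      ((hX₁.mem_iff _).1 hf₁).2 ha (ha.trans hab)
  · rintro ⟨hf, ht⟩
    exact mem_secondInterp hX₀ hX₁ hK hp₀ (by linarith) hσ₀ hp₁ (by linarith) hσ₁ hq0 hne hθ₀ hθ₁
      hq hf ht

end Main

lemma ballMass_le_morreyMass {σ r : ℝ} (hr : 0 < r) (φ : EuclideanSpace ℝ (Fin n) → ℝ≥0∞) :
    ballMass σ r φ ≤ ((1 : ℝ≥0) : ℝ≥0∞) * morreyMass σ φ := by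
  rw [ENNReal.coe_one, one_mul]
  exact le_iSup₂_of_le r hr le_rfl

lemma tendsto_morreyM_iff {p q σ : ℝ} (hp : 0 < p) (hq : 0 < q) (hσ : q / p = σ) {l : Filter ℝ}
    (hl : ∀ᶠ r in l, 0 < r) (f : FunClass n) :
    Tendsto (fun r => morreyM f p q r) l (𝓝 0) ↔
      Tendsto (fun r => ballMass σ r (fun y => ‖f y‖ₑ ^ q)) l (𝓝 0) := by
  have heq : (fun r => morreyM f p q r) =ᶠ[l]
      fun r => ballMass σ r (fun y => ‖f y‖ₑ ^ q) ^ (1 / q) :=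
    hl.mono fun r hr => morreyM_eq hp hq hσ hr f
  rw [tendsto_congr' heq]
  have key : ∀ {t : ℝ} {u : ℝ → ℝ≥0∞}, 0 < t → Tendsto u l (𝓝 0) →
      Tendsto (fun r => u r ^ t) l (𝓝 0) := fun {t u} ht hu => by
    have h := (ENNReal.continuous_rpow_const (y := t)).continuousAt.tendsto.comp hu
    rwa [ENNReal.zero_rpow_of_pos ht] at h
  refine ⟨fun h => ?_, fun h => key (by positivity) h⟩
  have h2 := key hq h
  simp_rw [← ENNReal.rpow_mul, one_div_mul_cancel hq.ne', ENNReal.rpow_one] at h2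
  exact h2

lemma isVanishingMorrey_vZero {p q σ : ℝ} (hp : 0 < p) (hq : 1 ≤ q) (hσ : q / p = σ) :
    IsVanishingMorrey (vZero n p q hq) p q (𝓝[>] 0)
      (fun r x => volume (Metric.ball x r) ^ (σ - 1)) (fun r x => Metric.ball x r) :=
  ⟨rfl, fun f => and_congr Iff.rfl
    (tendsto_morreyM_iff hp (by linarith) hσ self_mem_nhdsWithin f)⟩

lemma isVanishingMorrey_vInfty {p q σ : ℝ} (hp : 0 < p) (hq : 1 ≤ q) (hσ : q / p = σ) :
    IsVanishingMorrey (vInfty n p q hq) p q atTop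
      (fun r x => volume (Metric.ball x r) ^ (σ - 1)) (fun r x => Metric.ball x r) :=
  ⟨rfl, fun f => and_congr Iff.rfl
    (tendsto_morreyM_iff hp (by linarith) hσ (eventually_gt_atTop 0) f)⟩

lemma farMass_eq_supMass (f : FunClass n) (q N : ℝ) :
    farMass f q N = supMass (fun _ => 1) (fun x => (Metric.ball 0 N)ᶜ ∩ Metric.ball x 1)
      (fun y => ‖f y‖ₑ ^ q) := by
  unfold farMass supMass
  simp_rw [one_mul, setLIntegral_indicator measurableSet_ball.compl]

lemma isVanishingMorrey_vStar {p q : ℝ} (hq : 1 ≤ q) :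
    IsVanishingMorrey (vStar n p q hq) p q atTop
      (fun _ _ => 1) (fun N x => (Metric.ball 0 N)ᶜ ∩ Metric.ball x 1) :=
  ⟨rfl, fun f => and_congr Iff.rfl (by simp_rw [farMass_eq_supMass])⟩

lemma volume_ball_eq_zero_center (x : EuclideanSpace ℝ (Fin n)) (r : ℝ) :
    volume (Metric.ball x r) = volume (Metric.ball (0 : EuclideanSpace ℝ (Fin n)) r) :=
  Measure.addHaar_ball_center _ x r

lemma farMass_le_morreyMass (σ N : ℝ) (φ : EuclideanSpace ℝ (Fin n) → ℝ≥0∞) :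
    supMass (fun _ => 1) (fun x => (Metric.ball 0 N)ᶜ ∩ Metric.ball x 1) φ ≤
      ((volume (Metric.ball (0 : EuclideanSpace ℝ (Fin n)) 1) ^ (1 - σ)).toNNReal : ℝ≥0∞) *
        morreyMass σ φ := by
  rw [ENNReal.coe_toNNReal (ENNReal.rpow_ne_top_of_ne_zero
    (Metric.measure_ball_pos _ _ one_pos).ne' measure_ball_lt_top.ne)]
  refine iSup_le fun x => ?_
  rw [one_mul, ← volume_ball_eq_zero_center x 1]
  exact (lintegral_mono_set Set.inter_subset_right).trans
    (lintegral_ball_le_morreyMass one_pos x φ)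

/-- Truncations are bounded, so they satisfy the vanishing condition at the origin. -/
lemma tendsto_ballMass_truncation (hn : 1 ≤ n) {σ q : ℝ} (hσ : 0 < σ) (hq : 0 < q) (a b : ℝ)
    (f : FunClass n) :
    Tendsto (fun r => ballMass σ r (fun y => ‖truncation a b f y‖ₑ ^ q)) (𝓝[>] 0) (𝓝 0) := by
  set v : ℝ → ℝ≥0∞ := fun r => volume (Metric.ball (0 : EuclideanSpace ℝ (Fin n)) r) with hv
  have hvlim : Tendsto v (𝓝[>] 0) (𝓝 0) := by
    have h1 : ∀ᶠ r in 𝓝[>] (0 : ℝ), ENNReal.ofReal (r ^ n) *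
        volume (Metric.ball (0 : EuclideanSpace ℝ (Fin n)) 1) = v r := by
      filter_upwards [self_mem_nhdsWithin] with r hr
      rw [hv]
      simp only
      rw [Measure.addHaar_ball_of_pos _ _ hr, finrank_euclideanSpace_fin]
    refine Tendsto.congr' h1 ?_
    have h2 : Tendsto (fun r : ℝ => ENNReal.ofReal (r ^ n)) (𝓝 0) (𝓝 0) := by
      have : Continuous fun r : ℝ => ENNReal.ofReal (r ^ n) :=
        ENNReal.continuous_ofReal.comp (continuous_pow n)
      simpa [Nat.one_le_iff_ne_zero.1 hn] using this.tendsto 0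
    have h3 := ENNReal.Tendsto.mul_const h2 (Or.inr (measure_ball_lt_top
      (x := (0 : EuclideanSpace ℝ (Fin n))) (r := 1) (μ := volume)).ne)
    rw [zero_mul] at h3
    exact h3.mono_left nhdsWithin_le_nhds
  have hlim : Tendsto (fun r => ENNReal.ofReal b ^ q * v r ^ σ) (𝓝[>] 0) (𝓝 0) := by
    have h := (ENNReal.continuous_rpow_const (y := σ)).continuousAt.tendsto.comp hvlim
    rw [ENNReal.zero_rpow_of_pos hσ] at h
    have h2 := ENNReal.Tendsto.const_mul h
      (Or.inr (ENNReal.rpow_ne_top_of_nonneg hq.le (ENNReal.ofReal_ne_top (r := b))))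
    rwa [mul_zero] at h2
  refine tendsto_of_tendsto_of_tendsto_of_le_of_le' tendsto_const_nhds hlim
    (Eventually.of_forall fun _ => zero_le) ?_
  filter_upwards [self_mem_nhdsWithin] with r hr
  have hle : ∀ᵐ y, ‖truncation a b f y‖ₑ ^ q ≤ ENNReal.ofReal b ^ q := by
    filter_upwards [coeFn_truncation a b f] with y hy
    refine ENNReal.rpow_le_rpow ?_ hq.le
    rw [hy]
    by_cases hmem : y ∈ {y | a ≤ ‖f y‖ ∧ ‖f y‖ ≤ b}
    · rw [Set.indicator_of_mem hmem, ← ofReal_norm]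
      exact ENNReal.ofReal_le_ofReal hmem.2
    · rw [Set.indicator_of_notMem hmem, enorm_zero]
      exact zero_le
  refine (supMass_mono_ae hle).trans (iSup_le fun x => ?_)
  have h0 : volume (Metric.ball x r) ≠ 0 := (Metric.measure_ball_pos _ _ hr).ne'
  have h1 : volume (Metric.ball x r) ≠ ∞ := measure_ball_lt_top.ne
  rw [setLIntegral_const, mul_left_comm, hv]
  simp only
  rw [← volume_ball_eq_zero_center x r]
  nth_rewrite 2 [← ENNReal.rpow_one (volume (Metric.ball x r))]
  rw [← ENNReal.rpow_add _ _ h0 h1, sub_add_cancel]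

lemma enorm_truncation_le (a b : ℝ) (f : FunClass n) :
    ∀ᵐ y, ‖truncation a b f y‖ₑ ≤ ‖f y‖ₑ := by
  filter_upwards [coeFn_truncation a b f] with y hy
  rw [hy]
  by_cases hmem : y ∈ {y | a ≤ ‖f y‖ ∧ ‖f y‖ ≤ b}
  · rw [Set.indicator_of_mem hmem]
  · rw [Set.indicator_of_notMem hmem, enorm_zero]
    exact zero_le

lemma MemMorrey.truncation {p q σ : ℝ} (hp : 0 < p) (hq : 0 < q) (hσ : q / p = σ) {f : FunClass n}
    (hf : MemMorrey p q f) (a b : ℝ) : MemMorrey p q (truncation a b f) := by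
  rw [memMorrey_iff hp hq hσ] at hf ⊢
  exact (morreyMass_mono_ae ((enorm_truncation_le a b f).mono fun y hy =>
    ENNReal.rpow_le_rpow hy hq.le)).trans_lt hf

end

theorem theorem1p3 (n : ℕ) (hn : 1 ≤ n) (p₀ q₀ p₁ q₁ p q θ : ℝ)
    (hθ₀ : 0 < θ) (hθ₁ : θ < 1)
    (hq₀ : 1 ≤ q₀) (hqp₀ : q₀ ≤ p₀) (hq₁ : 1 ≤ q₁) (hqp₁ : q₁ ≤ p₁)
    (hprop : p₀ / q₀ = p₁ / q₁) (hne : q₀ ≠ q₁)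
    (hp : 1 / p = (1 - θ) / p₀ + θ / p₁) (hq : 1 / q = (1 - θ) / q₀ + θ / q₁) :
    secondInterp (vZero n p₀ q₀ hq₀) (vZero n p₁ q₁ hq₁) θ
        = {f | MemMorrey p q f} ∧
    secondInterp (vInfty n p₀ q₀ hq₀) (vInfty n p₁ q₁ hq₁) θ
        = {f | MemMorrey p q f ∧
            ∀ a b : ℝ, 0 < a → a < b → MemVInfty p q (truncation a b f)} ∧
    secondInterp (vStar n p₀ q₀ hq₀) (vStar n p₁ q₁ hq₁) θ
        = {f | MemMorrey p q f ∧
            ∀ a b : ℝ, 0 < a → a < b → MemVStar p q (truncation a b f)} := by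
  have hq₀p : 0 < q₀ := by linarith
  have hq₁p : 0 < q₁ := by linarith
  have hp₀p : 0 < p₀ := by linarith
  have hp₁p : 0 < p₁ := by linarith
  have hθ' : 0 < 1 - θ := by linarith
  have hqp : 0 < q := by
    have : 0 < 1 / q := by rw [hq]; positivity
    exact one_div_pos.1 this
  have hpp : 0 < p := by
    have : 0 < 1 / p := by rw [hp]; positivity
    exact one_div_pos.1 this
  obtain ⟨σ, hσ₀⟩ : ∃ σ, q₀ / p₀ = σ := ⟨_, rfl⟩
  have hσ₁ : q₁ / p₁ = σ := by
    rw [← hσ₀, ← inv_div, ← hprop, inv_div]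
  have hσp : 0 < σ := hσ₀ ▸ div_pos hq₀p hp₀p
  have hσ : q / p = σ := by
    have e₀ : 1 / p₀ = σ * (1 / q₀) := by rw [← hσ₀]; field_simp
    have e₁ : 1 / p₁ = σ * (1 / q₁) := by rw [← hσ₁]; field_simp
    have e : 1 / p = σ * (1 / q) := by
      rw [hp, hq, div_eq_mul_one_div, e₀, div_eq_mul_one_div θ, e₁]; ring
    calc q / p = q * (1 / p) := by ring
      _ = σ := by rw [e]; field_simp
  refine ⟨?_, ?_, ?_⟩
  · ext f
    rw [mem_secondInterp_iff (isVanishingMorrey_vZero hp₀p hq₀ hσ₀)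
      (isVanishingMorrey_vZero hp₁p hq₁ hσ₁)
      (by filter_upwards [self_mem_nhdsWithin] with r hr φ using ballMass_le_morreyMass hr φ)
      hp₀p hq₀ hσ₀ hp₁p hq₁ hσ₁ hqp hne hθ₀ hθ₁ hq, ← memMorrey_iff hpp hqp hσ]
    exact ⟨fun h => h.1, fun h => ⟨h, fun a b _ _ => tendsto_ballMass_truncation hn hσp hqp a b f⟩⟩
  · ext f
    rw [mem_secondInterp_iff (isVanishingMorrey_vInfty hp₀p hq₀ hσ₀)
      (isVanishingMorrey_vInfty hp₁p hq₁ hσ₁)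
      (by filter_upwards [eventually_gt_atTop 0] with r hr φ using ballMass_le_morreyMass hr φ)
      hp₀p hq₀ hσ₀ hp₁p hq₁ hσ₁ hqp hne hθ₀ hθ₁ hq, ← memMorrey_iff hpp hqp hσ]
    refine and_congr_right fun hf => forall₂_congr fun a b => forall₂_congr fun _ _ => ?_
    exact (tendsto_morreyM_iff hpp hqp hσ (eventually_gt_atTop 0) _).symm.trans
      ⟨fun h => ⟨hf.truncation hpp hqp hσ a b, h⟩, fun h => h.2⟩
  · ext f
    rw [mem_secondInterp_iff (isVanishingMorrey_vStar hq₀) (isVanishingMorrey_vStar hq₁)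
      (Eventually.of_forall fun N φ => farMass_le_morreyMass σ N φ)
      hp₀p hq₀ hσ₀ hp₁p hq₁ hσ₁ hqp hne hθ₀ hθ₁ hq, ← memMorrey_iff hpp hqp hσ]
    refine and_congr_right fun hf => forall₂_congr fun a b => forall₂_congr fun _ _ => ?_
    simp_rw [← farMass_eq_supMass]
    exact ⟨fun h => ⟨hf.truncation hpp hqp hσ a b, h⟩, fun h => h.2⟩
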